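/- **Setting.** Let $D$ be a probability distribution on pairs $(x,\ell)\in\mathcal X\times[0,1]^K$ (context, loss vector), and let $(x_t,\ell_t)_{t\ge1}$ be i.i.d. from $D$. Let $\Pi$ be a finite nonempty class of policies $\pi:\mathcal X\to\{1,\dots,K\}$. Put $L(\pi)=\mathbb E_{(x,\ell)\sim D}[\ell(\pi(x))]$, $\pi^*\in\arg\min_{\pi\in\Pi}L(\pi)$ and $\rho(\pi,\pi')=P_{x}(\pi(x)\neq\pi'(x))$. Let $0<\varepsilon\le1$, $0<\delta<1$ and, for $T\ge1$, $\delta_T=\delta/(T^2+T)$, $e_T=\log(2|\Pi|/\delta_T)/T$. **Algorithm (active $\varepsilon$-greedy).** In round $t$, given estimated loss vectors $\hat\ell_1,\dots,\hat\ell_{t-1}$, let $\hat L_{t-1}(\pi)=\frac1{t-1}\sum_{s<t}\hat\ell_s(\pi(x_s))$ (zero if $t=1$), and let $\pi_t\in\arg\min_{\pi\in\Pi}\hat L_{t-1}(\pi)$, with ties broken using past information only. Let $A_1=\{1,\dots,K\}$ and, for $t\ge2$, $$A_t=\Big\{a:\ \min_{\pi\in\Pi:\pi(x_t)=a}\hat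 L_{t-1}(\pi)-\hat L_{t-1}(\pi_t)\le\Delta_t\Big\},\qquad \Delta_t=2\Big(\sqrt{\tfrac{2K}{\varepsilon}}+1\Big)\sqrt{e_{t-1}}+\Big(\tfrac K\varepsilon+3\Big)e_{t-1}$$ (a minimum over the empty set is $+\infty$). Given the past, $x_t$ and $\ell_t$, the action $a_t$ is drawn from $p_t$, where $p_t(\pi_t(x_t))=1-(|A_t|-1)\varepsilon/K$, $p_t(a)=\varepsilon/K$ for $a\in A_t\setminus\{\pi_t(x_t)\}$, and $p_t(a)=0$ otherwise. Then $\hat\ell_t(a)=\frac{\mathbf 1\{a=a_t\}}{p_t(a_t)}\ell_t(a_t)$ for $a\in A_t$ and $\hat\ell_t(a)=1$ for $a\notin A_t$. Also put $\tilde\ell_t(a)=\ell_t(a)$ for $a\in A_t$ and $\tilde\ell_t(a)=1$ for $a\notin A_t$, and let $L_T(\pi),\tilde L_T(\pi)$ be the averages over $t\le T$ of $\ell_t(\pi(x_t))$, $\tilde\ell_t(\pi(x_t))$. The regret is $R_T=\sum_{t=1}^T\ell_t(a_t)-\sum_{t=1}^T\ell_t(\pi^*(x_t))$. **Event.** Let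 $\mathcal E$ be the event that for all $\pi\in\Pi$ and all $T\ge1$ $$\big|(\hat L_T(\pi)-\hat L_T(\pi^*))-(\tilde L_T(\pi)-\tilde L_T(\pi^*))\big|\le 2\sqrt{\tfrac{2K\rho(\pi,\pi^*)e_T}{\varepsilon}}+\Big(\tfrac K\varepsilon+1\Big)e_T,$$ $$\big|(L_T(\pi)-L_T(\pi^*))-(L(\pi)-L(\pi^*))\big|\le 2\sqrt{\rho(\pi,\pi^*)e_T}+2e_T.$$ **Theorem.** There is a universal constant $C>0$ such that in every such setting, without any noise assumption, $\Pr(\mathcal E)\ge1-\delta$ and, for every $T\ge1$, $$\mathbb E[R_T\mid\mathcal E]\le C\left(\sqrt{\frac{KT\log(T|\Pi|/\delta)}{\varepsilon}}+T\varepsilon\right).$$ For each $T\ge1$, the right-hand side is minimized over $\varepsilon\in(0,1]$ by $\varepsilon=\min\{1,(K\log(T|\Pi|/\delta)/(4T))^{1/3}\}$, and the algorithm run with this $\varepsilon$ satisfies $$\mathbb E[R_T\mid\mathcal E]\le C\,T^{2/3}\big(K\log(T|\Pi|/\delta)\big)^{1/3}.$$ -/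

import Mathlib

open MeasureTheory ProbabilityTheory

namespace ActiveGreedy

noncomputable section

/-- `e_T = log (2 N / δ_T) / T` with `δ_T = δ / (T² + T)`, where `N` is the number of policies. -/
def confTerm (N : ℕ) (δ : ℝ) (T : ℕ) : ℝ :=
  Real.log (2 * N / (δ / ((T : ℝ) ^ 2 + T))) / T

/-- The elimination threshold used after `T ≥ 1` completed rounds (that is, in round `T + 1`). -/
def threshold (K N : ℕ) (ε δ : ℝ) (T : ℕ) : ℝ :=
  2 * (√(2 * K / ε) + 1) * √(confTerm N δ T) + (K / ε + 3) * confTerm N δ T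

/-- The average loss `L(π, Z)` of a policy on the first `T` examples `(x t, c t)`;
it is `0` for the empty sample. -/
def empLoss {X : Type*} {K : ℕ} (x : ℕ → X) (c : ℕ → Fin K → ℝ) (T : ℕ) (π : X → Fin K) : ℝ :=
  (∑ t ∈ Finset.range T, c t (π (x t))) / T

/-- The expected loss `L(π)`. -/
def expLoss {X : Type*} [MeasurableSpace X] {K : ℕ} (D : Measure (X × (Fin K → ℝ)))
    (π : X → Fin K) : ℝ :=
  ∫ z, z.2 (π z.1) ∂D

/-- The expected disagreement `ρ(π, π')`. -/
def disagreement {X : Type*} [MeasurableSpace X] {K : ℕ} (D : Measure (X × (Fin K → ℝ)))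
    (π π' : X → Fin K) : ℝ :=
  D.real {z | π z.1 ≠ π' z.1}

/-- The probability of playing `b` when `A` is the set of explored actions and `g` is the
greedy action. -/
def playProb {K : ℕ} (ε : ℝ) (A : Finset (Fin K)) (g b : Fin K) : ℝ :=
  if b = g then 1 - ((A.card : ℝ) - 1) * ε / K else if b ∈ A then ε / K else 0

/-- The trajectories of an interaction. Rounds are numbered from `0`: the index `t` below refers
to round `t + 1` of the algorithm, so exactly `t` rounds are completed before it. -/
structure Interaction (X Ω : Type*) (K : ℕ) where
  /-- contexts -/
  x : ℕ → Ω → X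
  /-- full loss vectors -/
  loss : ℕ → Ω → Fin K → ℝ
  /-- actions played -/
  act : ℕ → Ω → Fin K
  /-- greedy policies -/
  greedy : ℕ → Ω → X → Fin K
  /-- sets of explored actions -/
  explored : ℕ → Ω → Finset (Fin K)

namespace Interaction

variable {X Ω : Type*} {K : ℕ}

/-- The probability with which the algorithm plays `b` in round `t`. -/
def prob (I : Interaction X Ω K) (ε : ℝ) (t : ℕ) (ω : Ω) (b : Fin K) : ℝ :=
  playProb ε (I.explored t ω) (I.greedy t ω (I.x t ω)) b

/-- The biased loss vector: unexplored actions get loss `1`. -/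
def biasedLoss (I : Interaction X Ω K) (t : ℕ) (ω : Ω) (b : Fin K) : ℝ :=
  if b ∈ I.explored t ω then I.loss t ω b else 1

/-- The inverse propensity estimate of the biased loss vector. -/
def ipsLoss (I : Interaction X Ω K) (ε : ℝ) (t : ℕ) (ω : Ω) (b : Fin K) : ℝ :=
  if b ∈ I.explored t ω then
    (if b = I.act t ω then I.loss t ω (I.act t ω) / I.prob ε t ω (I.act t ω) else 0)
  else 1

/-- `L_T(π)`: average of the true losses in the first `T` rounds. -/
def trueEmp (I : Interaction X Ω K) (T : ℕ) (ω : Ω) (π : X → Fin K) : ℝ :=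
  empLoss (fun t => I.x t ω) (fun t => I.loss t ω) T π

/-- Average of the biased losses in the first `T` rounds. -/
def biasedEmp (I : Interaction X Ω K) (T : ℕ) (ω : Ω) (π : X → Fin K) : ℝ :=
  empLoss (fun t => I.x t ω) (fun t => I.biasedLoss t ω) T π

/-- Average of the estimated losses in the first `T` rounds. -/
def ipsEmp (I : Interaction X Ω K) (ε : ℝ) (T : ℕ) (ω : Ω) (π : X → Fin K) : ℝ :=
  empLoss (fun t => I.x t ω) (fun t => I.ipsLoss ε t ω) T π

/-- The regret `R_T` with respect to the policy `πstar`. -/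
def regret (I : Interaction X Ω K) (πstar : X → Fin K) (T : ℕ) (ω : Ω) : ℝ :=
  ∑ t ∈ Finset.range T, I.loss t ω (I.act t ω)
    - ∑ t ∈ Finset.range T, I.loss t ω (πstar (I.x t ω))

/-- The event on which all deviation bounds hold, for all policies and all horizons. -/
def deviationEvent [MeasurableSpace X] (I : Interaction X Ω K) (D : Measure (X × (Fin K → ℝ)))
    (P : Finset (X → Fin K)) (πstar : X → Fin K) (ε δ : ℝ) : Set Ω :=
  {ω | ∀ π ∈ P, ∀ T : ℕ, 1 ≤ T →
    |(I.ipsEmp ε T ω π - I.ipsEmp ε T ω πstar) - (I.biasedEmp T ω π - I.biasedEmp T ω πstar)|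
      ≤ 2 * √(2 * K * disagreement D π πstar * confTerm P.card δ T / ε)
        + (K / ε + 1) * confTerm P.card δ T ∧
    |(I.trueEmp T ω π - I.trueEmp T ω πstar) - (expLoss D π - expLoss D πstar)|
      ≤ 2 * √(disagreement D π πstar * confTerm P.card δ T) + 2 * confTerm P.card δ T}

/-- `I` is a run of the analyzed active ε-greedy algorithm, with policy class `P` and parameters
`ε`, `δ`, on i.i.d. data from `D`. Here `ℱ t` is the information available after `t` rounds. -/
structure IsRun [MeasurableSpace X] [mΩ : MeasurableSpace Ω] (I : Interaction X Ω K)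
    (ℱ : Filtration ℕ mΩ) (μ : Measure Ω) (D : Measure (X × (Fin K → ℝ)))
    (P : Finset (X → Fin K)) (ε δ : ℝ) : Prop where
  measurable_x : ∀ t, Measurable[ℱ (t + 1)] (I.x t)
  measurable_loss : ∀ t, Measurable[ℱ (t + 1)] (I.loss t)
  measurable_act : ∀ t, Measurable[ℱ (t + 1)] (I.act t)
  /-- every pair of a context and a loss vector has law `D` … -/
  law : ∀ t, μ.map (fun ω => (I.x t ω, I.loss t ω)) = D
  /-- … and is independent of the past -/
  indep : ∀ t, Indep
    (MeasurableSpace.comap (fun ω => (I.x t ω, I.loss t ω)) inferInstance) (ℱ t) μ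
  /-- the greedy policy is chosen from past information, with any tie-breaking rule, … -/
  measurable_greedy : ∀ t, ∀ π ∈ P, MeasurableSet[ℱ t] {ω | I.greedy t ω = π}
  greedy_mem : ∀ t ω, I.greedy t ω ∈ P
  /-- … and minimizes the estimated loss on past data over the policy class -/
  greedy_min : ∀ t ω, ∀ π ∈ P, I.ipsEmp ε t ω (I.greedy t ω) ≤ I.ipsEmp ε t ω π
  /-- in the first round all actions are explored -/
  explored_zero : ∀ ω, I.explored 0 ω = Finset.univ
  /-- later, `b` is explored iff the least estimated loss of a policy choosing `b` exceeds
  the least estimated loss by at most the threshold (the class being finite, iff some policy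
  choosing `b` is within the threshold) -/
  mem_explored : ∀ t, 1 ≤ t → ∀ ω b, b ∈ I.explored t ω ↔
    ∃ π ∈ P, π (I.x t ω) = b ∧
      I.ipsEmp ε t ω π - I.ipsEmp ε t ω (I.greedy t ω) ≤ threshold K P.card ε δ t
  /-- given the past, the context and the losses, the action is drawn from `prob` -/
  act_law : ∀ t b,
    μ[{ω | I.act t ω = b}.indicator (fun _ => (1 : ℝ)) |
        ℱ t ⊔ MeasurableSpace.comap (fun ω => (I.x t ω, I.loss t ω)) inferInstance]
      =ᵐ[μ] fun ω => I.prob ε t ω b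

end Interaction

/-- The rate `√(K T log(T N / δ) / ε) + T ε`. -/
def rate (K N T : ℕ) (δ ε : ℝ) : ℝ :=
  √(K * T * Real.log (T * N / δ) / ε) + T * ε

/-- The choice of the exploration probability in `(0, 1]` that minimizes `rate`. -/
def tunedEps (K N T : ℕ) (δ : ℝ) : ℝ :=
  min 1 ((K * Real.log (T * N / δ) / (4 * T)) ^ (1 / 3 : ℝ))

end

end ActiveGreedy

/-!
Both deviation bounds are Bernstein inequalities for bounded martingale differences, whose
conditional variances are at most `2 K ρ(π, π*) / ε` and `ρ(π, π*)`. A union bound over the two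
families, the policies and the horizons leaves probability at least `1 - δ / 2 ≥ 1 / 2` for the
event, so conditioning on it at most doubles the expectation of a nonnegative variable.

On the event, replacing the losses of eliminated actions by `1` only makes policies look worse, and
as long as `π*` has not been eliminated its own losses are not replaced. Hence the estimated gap of
a policy to `π*` dominates its true gap up to the threshold. By induction `π*` is never eliminated,
and since the greedy policy has a nonpositive estimated gap, its true gap is at most the threshold.
Exploring costs at most `ε` more per round. The regret is thus the sum of these drifts and of a
martingale whose expected absolute value is `O(√T)`.

With one policy, `log (T N / δ)` may be arbitrarily small, so constants cannot be absorbed by it;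
but then the event is the whole space and the greedy policy is `π*`.
-/

namespace ActiveGreedy

/-! ### Bounded martingale differences -/

lemma exp_le_one_add_add_sq_div {x b : ℝ} (hx : |x| ≤ b) (hb : b < 3) :
    Real.exp x ≤ 1 + x + x ^ 2 / (2 * (1 - b / 3)) := by
  have hb0 : 0 ≤ b := (abs_nonneg x).trans hx
  have hexp : HasSum (fun n : ℕ => x ^ n / n.factorial) (Real.exp x) := by
    rw [Real.exp_eq_exp_ℝ]
    exact NormedSpace.expSeries_div_hasSum_exp x
  have hgeom : HasSum (fun n : ℕ => x ^ 2 / 2 * (b / 3) ^ n) (x ^ 2 / 2 * (1 - b / 3)⁻¹) :=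
    (hasSum_geometric_of_lt_one (by positivity) (by linarith)).mul_left _
  have hterm : ∀ n : ℕ, x ^ (n + 2) / ((n + 2).factorial : ℝ) ≤ x ^ 2 / 2 * (b / 3) ^ n := by
    intro n
    have hfactorial : (2 * 3 ^ n : ℝ) ≤ ((n + 2).factorial : ℝ) := by
      rw [add_comm n]
      exact_mod_cast Nat.factorial_mul_pow_le_factorial (m := 2) (n := n)
    have hpow : x ^ n ≤ b ^ n :=
      (le_abs_self _).trans (by rw [abs_pow]; exact pow_le_pow_left₀ (abs_nonneg x) hx n)
    calc x ^ (n + 2) / ((n + 2).factorial : ℝ)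
        = x ^ 2 * x ^ n / ((n + 2).factorial : ℝ) := by ring
      _ ≤ x ^ 2 * b ^ n / (2 * 3 ^ n) := by gcongr
      _ = x ^ 2 / 2 * (b / 3) ^ n := by rw [div_pow]; field_simp
  have htail := hasSum_le hterm ((hasSum_nat_add_iff' 2).mpr hexp) hgeom
  simp only [Finset.sum_range_succ, Finset.sum_range_zero, pow_zero, pow_one, Nat.factorial_zero,
    Nat.factorial_one, Nat.cast_one, div_one, zero_add] at htail
  rw [← div_div, div_eq_mul_inv (x ^ 2 / 2)]
  linarith

/-- The infimum over `l` of `l ^ 2 * V / (2 * (1 - l * c)) - l * (√(2 * V * u) + c * u)` is at most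
`-u`; for `V = 0` it is approached as `l → 1 / c`. -/
lemma le_exp_neg_of_forall_le_exp {p V c u : ℝ} (hV : 0 ≤ V) (hc : 0 < c) (hu : 0 ≤ u)
    (hp : ∀ l, 0 ≤ l → l * c < 1 →
      p ≤ Real.exp (l ^ 2 * V / (2 * (1 - l * c)) - l * (√(2 * V * u) + c * u))) :
    p ≤ Real.exp (-u) := by
  rcases hV.eq_or_lt with rfl | hV
  · have hlim : Filter.Tendsto (fun r : ℝ => Real.exp (-(r * u))) (nhdsWithin 1 (Set.Iio 1))
        (nhds (Real.exp (-(1 * u)))) :=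
      (by fun_prop : Continuous fun r : ℝ => Real.exp (-(r * u))).continuousWithinAt
    rw [one_mul] at hlim
    refine ge_of_tendsto hlim ?_
    filter_upwards [Ioo_mem_nhdsLT (zero_lt_one (α := ℝ))] with r hr
    have := hp (r / c) (by have := hr.1; positivity) (by rw [div_mul_cancel₀ _ hc.ne']; exact hr.2)
    refine this.trans_eq ?_
    congr 1
    simp only [mul_zero, zero_mul, zero_div, Real.sqrt_zero]
    field_simp
    ring
  · set s := √(2 * V * u)
    have hs : 0 ≤ s := Real.sqrt_nonneg _
    have hu_eq : u = s ^ 2 / (2 * V) := by rw [Real.sq_sqrt (by positivity)]; field_simp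
    have : 0 < V + c * s := by positivity
    have hone_sub : 1 - s / (V + c * s) * c = V / (V + c * s) := by field_simp; ring
    have hpos : 0 < V / (V + c * s) := by positivity
    refine (hp (s / (V + c * s)) (by positivity) (by linarith)).trans_eq ?_
    rw [hone_sub, hu_eq]
    congr 1
    field_simp
    ring

section MartingaleDifference

variable {Ω : Type*} {mΩ : MeasurableSpace Ω} {μ : Measure Ω}

lemma integral_abs_le_sqrt_integral_sq [IsProbabilityMeasure μ] {f : Ω → ℝ} (hf : MemLp f 2 μ) :
    ∫ ω, |f ω| ∂μ ≤ √(∫ ω, f ω ^ 2 ∂μ) := by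
  refine Real.le_sqrt_of_sq_le ?_
  have hvar := variance_nonneg |f| μ
  rw [variance_eq_sub hf.abs] at hvar
  simpa only [Pi.pow_apply, Pi.abs_apply, sq_abs, sub_nonneg] using hvar

lemma integral_mul_eq_zero_of_condExp_eq_zero [IsFiniteMeasure μ] {m : MeasurableSpace Ω}
    (hm : m ≤ mΩ) {f g : Ω → ℝ} (hf : StronglyMeasurable[m] f) (hfg : Integrable (f * g) μ)
    (hg : Integrable g μ) (hg0 : μ[g | m] =ᵐ[μ] 0) : ∫ ω, f ω * g ω ∂μ = 0 := by
  change ∫ ω, (f * g) ω ∂μ = 0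
  rw [← integral_condExp hm]
  refine integral_eq_zero_of_ae ?_
  filter_upwards [condExp_mul_of_stronglyMeasurable_left hf hfg hg, hg0] with ω hpull hzero
  rw [hpull, Pi.mul_apply, hzero, Pi.zero_apply, mul_zero]

lemma condExp_exp_le [IsProbabilityMeasure μ] {m : MeasurableSpace Ω} (hm : m ≤ mΩ) {f : Ω → ℝ}
    {R v l : ℝ} (hf : Measurable[mΩ] f) (hbound : ∀ᵐ ω ∂μ, |f ω| ≤ R)
    (hmean : μ[f | m] =ᵐ[μ] 0) (hvar : μ[fun ω => f ω ^ 2 | m] ≤ᵐ[μ] fun _ => v)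
    (hl : 0 ≤ l) (hlR : l * R < 3) :
    μ[fun ω => Real.exp (l * f ω) | m]
      ≤ᵐ[μ] fun _ => Real.exp (l ^ 2 * v / (2 * (1 - l * R / 3))) := by
  set c : ℝ := l ^ 2 / (2 * (1 - l * R / 3))
  have hc0 : 0 ≤ c := div_nonneg (sq_nonneg l) (by linarith)
  have hL2 : MemLp f 2 μ := .of_bound hf.aestronglyMeasurable R hbound
  have hint : Integrable f μ := hL2.integrable (by norm_num)
  have hexp : Integrable (fun ω => Real.exp (l * f ω)) μ :=
    integrable_exp_mul_of_mem_Icc hf.aemeasurable (hbound.mono fun _ => abs_le.mp)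
  have hquadratic : μ[fun ω => Real.exp (l * f ω) | m]
      ≤ᵐ[μ] μ[(fun _ => (1 : ℝ)) + (l • f + c • fun ω => f ω ^ 2) | m] := by
    refine condExp_mono hexp
      ((integrable_const _).add ((hint.smul l).add (hL2.integrable_sq.smul c))) ?_
    filter_upwards [hbound] with ω hω
    refine (exp_le_one_add_add_sq_div (x := l * f ω) (b := l * R) ?_ hlR).trans_eq ?_
    · rw [abs_mul, abs_of_nonneg hl]; gcongr
    · simp only [Pi.add_apply, Pi.smul_apply, smul_eq_mul, c]; ring
  filter_upwards [hquadratic,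
    condExp_add (integrable_const (1 : ℝ)) ((hint.smul l).add (hL2.integrable_sq.smul c)) m,
    condExp_add (hint.smul l) (hL2.integrable_sq.smul c) m, condExp_smul l f m,
    condExp_smul c (fun ω => f ω ^ 2) m, hmean, hvar] with ω hω hadd hadd' hsmul hsmul' h0 hv
  simp only [hadd, Pi.add_apply, hadd', hsmul, hsmul', Pi.smul_apply, h0, condExp_const hm,
    Pi.zero_apply, smul_eq_mul, mul_zero, zero_add] at hω
  calc μ[fun ω => Real.exp (l * f ω) | m] ω ≤ 1 + c * v := by grw [hω, hv]
    _ ≤ Real.exp (c * v) := by linarith [Real.add_one_le_exp (c * v)]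
    _ = Real.exp (l ^ 2 * v / (2 * (1 - l * R / 3))) := by simp only [c]; ring_nf

/-- `d` is a sequence of martingale differences for `ℱ`, bounded by `R`; the variable `d t` is
revealed between the times `t` and `t + 1`. -/
structure IsMartingaleDifference (d : ℕ → Ω → ℝ) (ℱ : Filtration ℕ mΩ) (μ : Measure Ω)
    (R : ℝ) : Prop where
  measurable : ∀ t, Measurable[ℱ (t + 1)] (d t)
  abs_le : ∀ t, ∀ᵐ ω ∂μ, |d t ω| ≤ R
  condExp_eq_zero : ∀ t, μ[d t | ℱ t] =ᵐ[μ] 0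

namespace IsMartingaleDifference

variable {ℱ : Filtration ℕ mΩ} {d : ℕ → Ω → ℝ} {R : ℝ}

lemma neg (h : IsMartingaleDifference d ℱ μ R) :
    IsMartingaleDifference (fun t => -d t) ℱ μ R where
  measurable t := (h.measurable t).neg
  abs_le t := by simpa only [Pi.neg_apply, abs_neg] using h.abs_le t
  condExp_eq_zero t := by
    filter_upwards [condExp_neg (d t) (ℱ t), h.condExp_eq_zero t] with ω hneg hzero
    rw [hneg, Pi.neg_apply, hzero, Pi.zero_apply, neg_zero]

lemma measurable_sum (h : IsMartingaleDifference d ℱ μ R) (T : ℕ) :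
    Measurable[ℱ T] (fun ω => ∑ t ∈ Finset.range T, d t ω) :=
  Finset.measurable_fun_sum _ fun t ht =>
    (h.measurable t).mono (ℱ.mono (Nat.succ_le_of_lt (Finset.mem_range.mp ht))) le_rfl

lemma abs_sum_le (h : IsMartingaleDifference d ℱ μ R) (T : ℕ) :
    ∀ᵐ ω ∂μ, |∑ t ∈ Finset.range T, d t ω| ≤ T * R := by
  filter_upwards [ae_all_iff.mpr h.abs_le] with ω hω
  calc |∑ t ∈ Finset.range T, d t ω| ≤ ∑ t ∈ Finset.range T, |d t ω| :=
        Finset.abs_sum_le_sum_abs _ _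
    _ ≤ ∑ _t ∈ Finset.range T, R := Finset.sum_le_sum fun t _ => hω t
    _ = T * R := by rw [Finset.sum_const, Finset.card_range, nsmul_eq_mul]

lemma memLp [IsFiniteMeasure μ] (h : IsMartingaleDifference d ℱ μ R) (t : ℕ) (p : ENNReal) :
    MemLp (d t) p μ :=
  .of_bound ((h.measurable t).mono (ℱ.le _) le_rfl).aestronglyMeasurable R (h.abs_le t)

lemma memLp_sum [IsFiniteMeasure μ] (h : IsMartingaleDifference d ℱ μ R) (T : ℕ) (p : ENNReal) :
    MemLp (fun ω => ∑ t ∈ Finset.range T, d t ω) p μ :=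
  memLp_finsetSum _ fun t _ => h.memLp t p

lemma integrable_exp_mul_sum [IsFiniteMeasure μ] (h : IsMartingaleDifference d ℱ μ R) (l : ℝ)
    (T : ℕ) : Integrable (fun ω => Real.exp (l * ∑ t ∈ Finset.range T, d t ω)) μ :=
  integrable_exp_mul_of_mem_Icc ((h.measurable_sum T).mono (ℱ.le T) le_rfl).aemeasurable
    ((h.abs_sum_le T).mono fun _ => _root_.abs_le.mp)

variable [IsProbabilityMeasure μ]

lemma mgf_sum_le (h : IsMartingaleDifference d ℱ μ R) {v l : ℝ}
    (hvar : ∀ t, μ[fun ω => d t ω ^ 2 | ℱ t] ≤ᵐ[μ] fun _ => v)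
    (hl : 0 ≤ l) (hlR : l * R < 3) (T : ℕ) :
    mgf (fun ω => ∑ t ∈ Finset.range T, d t ω) μ l
      ≤ Real.exp (T * (l ^ 2 * v / (2 * (1 - l * R / 3)))) := by
  set ψ := l ^ 2 * v / (2 * (1 - l * R / 3))
  induction T with
  | zero => simp [mgf]
  | succ T ih =>
    set S : Ω → ℝ := fun ω => ∑ t ∈ Finset.range T, d t ω
    have hSm : Measurable[ℱ T] S := h.measurable_sum T
    have hdm : Measurable (d T) := (h.measurable T).mono (ℱ.le _) le_rfl
    have hsplit : (fun ω => Real.exp (l * ∑ t ∈ Finset.range (T + 1), d t ω))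
        = (fun ω => Real.exp (l * S ω)) * fun ω => Real.exp (l * d T ω) := by
      ext ω
      simp only [Finset.sum_range_succ, Pi.mul_apply, ← Real.exp_add, S, mul_add]
    have hpull := condExp_mul_of_stronglyMeasurable_left (μ := μ) (m := ℱ T)
      (Measurable.stronglyMeasurable (by fun_prop : Measurable[ℱ T] fun ω => Real.exp (l * S ω)))
      (hsplit ▸ h.integrable_exp_mul_sum l (T + 1))
      (integrable_exp_mul_of_mem_Icc hdm.aemeasurable
        ((h.abs_le T).mono fun _ => _root_.abs_le.mp))
    calc mgf (fun ω => ∑ t ∈ Finset.range (T + 1), d t ω) μ l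
        = ∫ ω, (μ[(fun ω => Real.exp (l * S ω)) * fun ω => Real.exp (l * d T ω) | ℱ T]) ω ∂μ := by
          rw [integral_condExp (ℱ.le T), ← hsplit, mgf]
      _ ≤ ∫ ω, Real.exp (l * S ω) * Real.exp ψ ∂μ := by
          refine integral_mono_ae integrable_condExp
            ((h.integrable_exp_mul_sum l T).mul_const _) ?_
          filter_upwards [hpull, condExp_exp_le (ℱ.le T) hdm (h.abs_le T) (h.condExp_eq_zero T)
            (hvar T) hl hlR] with ω hω hexp
          rw [hω, Pi.mul_apply]
          gcongr
      _ = mgf S μ l * Real.exp ψ := by rw [integral_mul_const, mgf]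
      _ ≤ Real.exp (T * ψ) * Real.exp ψ := by gcongr
      _ = Real.exp ((T + 1 : ℕ) * ψ) := by rw [← Real.exp_add]; push_cast; ring_nf

/-- **Bernstein's inequality** for martingale differences. -/
theorem measureReal_le_sum_le (h : IsMartingaleDifference d ℱ μ R) {v u : ℝ}
    (hvar : ∀ t, μ[fun ω => d t ω ^ 2 | ℱ t] ≤ᵐ[μ] fun _ => v)
    (hv : 0 ≤ v) (hR : 0 < R) (hu : 0 ≤ u) (T : ℕ) :
    μ.real {ω | √(2 * (T * v) * u) + R / 3 * u ≤ ∑ t ∈ Finset.range T, d t ω}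
      ≤ Real.exp (-u) := by
  refine le_exp_neg_of_forall_le_exp (V := T * v) (c := R / 3) (by positivity) (by positivity) hu
    fun l hl hlR => ?_
  refine (measure_ge_le_exp_mul_mgf _ hl (h.integrable_exp_mul_sum l T)).trans ?_
  grw [h.mgf_sum_le hvar hl (by linarith) T]
  rw [← Real.exp_add]
  exact le_of_eq (by ring_nf)

theorem measureReal_lt_abs_average_le (h : IsMartingaleDifference d ℱ μ R) {v e : ℝ}
    (hvar : ∀ t, μ[fun ω => d t ω ^ 2 | ℱ t] ≤ᵐ[μ] fun _ => v)
    (hv : 0 ≤ v) (hR : 0 < R) (he : 0 ≤ e) {T : ℕ} (hT : 1 ≤ T) :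
    μ.real {ω | 2 * √(v * e) + R * e < |(∑ t ∈ Finset.range T, d t ω) / T|}
      ≤ 2 * Real.exp (-(2 * (T * e))) := by
  have hT0 : (0 : ℝ) < T := by exact_mod_cast hT
  set r := √(2 * (T * v) * (2 * (T * e))) + R / 3 * (2 * (T * e))
  have hr : r ≤ T * (2 * √(v * e) + R * e) := by
    have hsqrt : √(2 * (T * v) * (2 * (T * e))) = 2 * T * √(v * e) := by
      rw [show 2 * (T * v) * (2 * (T * e)) = (2 * T : ℝ) ^ 2 * (v * e) by ring,
        Real.sqrt_mul (by positivity), Real.sqrt_sq (by positivity)]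
    have : 0 ≤ R * T * e := by positivity
    simp only [r, hsqrt]
    linarith
  have hupper := h.measureReal_le_sum_le (u := 2 * (T * e)) hvar hv hR (by positivity) T
  have hlower := h.neg.measureReal_le_sum_le (u := 2 * (T * e))
    (by simpa only [Pi.neg_apply, neg_sq] using hvar) hv hR (by positivity) T
  calc μ.real {ω | 2 * √(v * e) + R * e < |(∑ t ∈ Finset.range T, d t ω) / T|}
      ≤ μ.real ({ω | r ≤ ∑ t ∈ Finset.range T, d t ω}
        ∪ {ω | r ≤ ∑ t ∈ Finset.range T, (-d t) ω}) := by
        refine measureReal_mono fun ω hω => ?_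
        simp only [Set.mem_ofPred_eq, abs_div, Nat.abs_cast, lt_div_iff₀ hT0] at hω
        simp only [Set.mem_union, Set.mem_ofPred_eq, Pi.neg_apply, Finset.sum_neg_distrib]
        exact (lt_abs.mp hω).imp (fun hlt => by linarith) fun hlt => by linarith
    _ ≤ Real.exp (-(2 * (T * e))) + Real.exp (-(2 * (T * e))) :=
        (measureReal_union_le _ _).trans (add_le_add hupper hlower)
    _ = 2 * Real.exp (-(2 * (T * e))) := (two_mul _).symm

lemma integral_sum_sq_le (h : IsMartingaleDifference d ℱ μ R) (T : ℕ) :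
    ∫ ω, (∑ t ∈ Finset.range T, d t ω) ^ 2 ∂μ ≤ T * R ^ 2 := by
  induction T with
  | zero => simp
  | succ T ih =>
    set S : Ω → ℝ := fun ω => ∑ t ∈ Finset.range T, d t ω
    have hcross_int : Integrable (fun ω => S ω * d T ω) μ :=
      (h.memLp_sum T 2).integrable_mul (h.memLp T 2)
    have hcross : ∫ ω, S ω * d T ω ∂μ = 0 :=
      integral_mul_eq_zero_of_condExp_eq_zero (ℱ.le T) (h.measurable_sum T).stronglyMeasurable
        hcross_int (memLp_one_iff_integrable.mp (h.memLp T 1)) (h.condExp_eq_zero T)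
    have hsq : ∫ ω, d T ω ^ 2 ∂μ ≤ R ^ 2 := by
      refine (integral_mono_ae (h.memLp T 2).integrable_sq (integrable_const (R ^ 2)) ?_).trans_eq
        (by simp)
      filter_upwards [h.abs_le T] with ω hω
      exact sq_le_sq' (_root_.abs_le.mp hω).1 (_root_.abs_le.mp hω).2
    calc ∫ ω, (∑ t ∈ Finset.range (T + 1), d t ω) ^ 2 ∂μ
        = ∫ ω, (S ω ^ 2 + (2 * (S ω * d T ω) + d T ω ^ 2)) ∂μ := by
          simp only [Finset.sum_range_succ, S]; congr 1; ext ω; ring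
      _ = ∫ ω, S ω ^ 2 ∂μ + (2 * ∫ ω, S ω * d T ω ∂μ + ∫ ω, d T ω ^ 2 ∂μ) := by
          have hsum_int : Integrable (fun ω => 2 * (S ω * d T ω) + d T ω ^ 2) μ :=
            (hcross_int.const_mul 2).add (h.memLp T 2).integrable_sq
          rw [integral_add (h.memLp_sum T 2).integrable_sq hsum_int,
            integral_add (hcross_int.const_mul 2) (h.memLp T 2).integrable_sq, integral_const_mul]
      _ ≤ (T + 1 : ℕ) * R ^ 2 := by rw [hcross]; push_cast; linarith

lemma integral_abs_sum_le (h : IsMartingaleDifference d ℱ μ R) (hR : 0 ≤ R) (T : ℕ) :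
    ∫ ω, |∑ t ∈ Finset.range T, d t ω| ∂μ ≤ R * √T :=
  calc ∫ ω, |∑ t ∈ Finset.range T, d t ω| ∂μ
      ≤ √(∫ ω, (∑ t ∈ Finset.range T, d t ω) ^ 2 ∂μ) :=
        integral_abs_le_sqrt_integral_sq (h.memLp_sum T 2)
    _ ≤ √(T * R ^ 2) := Real.sqrt_le_sqrt (h.integral_sum_sq_le T)
    _ = R * √T := by rw [Real.sqrt_mul (Nat.cast_nonneg T), Real.sqrt_sq hR, mul_comm]

end IsMartingaleDifference

section Drift

variable {d : ℕ → Ω → ℝ} {ℱ : Filtration ℕ mΩ} {R : ℝ}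

lemma isMartingaleDifference_sub_condExp [IsFiniteMeasure μ]
    (hd : ∀ t, Measurable[ℱ (t + 1)] (d t)) (hR : ∀ t, ∀ᵐ ω ∂μ, |d t ω| ≤ R) :
    IsMartingaleDifference (fun t => d t - μ[d t | ℱ t]) ℱ μ (2 * R) where
  measurable t := (hd t).sub
    (stronglyMeasurable_condExp.measurable.mono (ℱ.mono (Nat.le_succ t)) le_rfl)
  abs_le t := by
    filter_upwards [hR t, ae_bdd_abs_condExp_of_ae_bdd_abs (m := ℱ t) (hR t)] with ω hω hcond
    exact (abs_sub _ _).trans (by linarith)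
  condExp_eq_zero t := by
    have hint : Integrable (d t) μ :=
      .of_bound ((hd t).mono (ℱ.le _) le_rfl).aestronglyMeasurable R (hR t)
    refine (condExp_sub hint integrable_condExp (ℱ t)).trans ?_
    rw [condExp_of_stronglyMeasurable (ℱ.le t) stronglyMeasurable_condExp integrable_condExp,
      sub_self]

theorem setIntegral_sum_le_of_sum_condExp_le [IsProbabilityMeasure μ]
    (hd : ∀ t, Measurable[ℱ (t + 1)] (d t)) (hR : ∀ t, ∀ᵐ ω ∂μ, |d t ω| ≤ R) (hR0 : 0 ≤ R)
    {E : Set Ω} (hE : MeasurableSet E) {B : ℝ} (hB : 0 ≤ B) (T : ℕ)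
    (hdrift : ∀ᵐ ω ∂μ, ω ∈ E → ∑ t ∈ Finset.range T, (μ[d t | ℱ t]) ω ≤ B) :
    ∫ ω in E, ∑ t ∈ Finset.range T, d t ω ∂μ ≤ 2 * R * √T + B := by
  have hnoise := isMartingaleDifference_sub_condExp hd hR
  set N : Ω → ℝ := fun ω => ∑ t ∈ Finset.range T, (d t - μ[d t | ℱ t]) ω with hN
  have hNint : Integrable N μ := memLp_one_iff_integrable.mp (hnoise.memLp_sum T 1)
  have hint : Integrable (fun ω => ∑ t ∈ Finset.range T, d t ω) μ :=
    integrable_finsetSum _ fun t _ =>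
      .of_bound ((hd t).mono (ℱ.le _) le_rfl).aestronglyMeasurable R (hR t)
  calc ∫ ω in E, ∑ t ∈ Finset.range T, d t ω ∂μ
      ≤ ∫ ω in E, (|N ω| + B) ∂μ := by
        refine setIntegral_mono_on_ae hint.integrableOn
          (hNint.abs.add (integrable_const B)).integrableOn hE ?_
        filter_upwards [hdrift] with ω hω hωE
        have hsplit : ∑ t ∈ Finset.range T, d t ω
            = N ω + ∑ t ∈ Finset.range T, (μ[d t | ℱ t]) ω := by
          simp only [hN, Pi.sub_apply, Finset.sum_sub_distrib, sub_add_cancel]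
        linarith [hω hωE, le_abs_self (N ω)]
    _ ≤ ∫ ω, (|N ω| + B) ∂μ :=
        setIntegral_le_integral (hNint.abs.add (integrable_const B))
          (.of_forall fun ω => add_nonneg (abs_nonneg (N ω)) hB)
    _ = ∫ ω, |N ω| ∂μ + B := by
        rw [integral_add hNint.abs (integrable_const B), integral_const, probReal_univ, one_smul]
    _ ≤ 2 * R * √T + B := by
        gcongr
        exact hnoise.integral_abs_sum_le (by positivity) T

end Drift

end MartingaleDifference

/-! ### Conditional expectations and finite-valued choices -/

section FiniteChoice

variable {Ω β γ : Type*} {m mΩ : MeasurableSpace Ω} {μ : Measure Ω}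

lemma measurable_eval_of_mem_finset [MeasurableSpace γ] {s : Finset β} {g : Ω → β}
    {F : β → Ω → γ} (hgs : ∀ ω, g ω ∈ s) (hg : ∀ b ∈ s, MeasurableSet[m] {ω | g ω = b})
    (hF : ∀ b ∈ s, Measurable[m] (F b)) : Measurable[m] fun ω => F (g ω) ω := by
  intro u hu
  have hcover : (fun ω => F (g ω) ω) ⁻¹' u = ⋃ b ∈ s, {ω | g ω = b} ∩ F b ⁻¹' u := by
    ext ω
    simp only [Set.mem_preimage, Set.mem_iUnion, Set.mem_inter_iff, Set.mem_ofPred_eq, exists_prop]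
    exact ⟨fun hω => ⟨g ω, hgs ω, rfl, hω⟩, fun ⟨_, _, hb, hω⟩ => hb ▸ hω⟩
  rw [hcover]
  exact .biUnion s.countable_toSet fun b hb => (hg b hb).inter (hF b hb hu)

lemma measurable_eval [MeasurableSpace γ] [Finite β] [MeasurableSpace β]
    [MeasurableSingletonClass β] {g : Ω → β} {F : β → Ω → γ} (hg : Measurable[m] g)
    (hF : ∀ b, Measurable[m] (F b)) : Measurable[m] fun ω => F (g ω) ω := by
  have := Fintype.ofFinite β
  exact measurable_eval_of_mem_finset (s := Finset.univ) (fun _ => Finset.mem_univ _)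
    (fun b _ => hg (measurableSet_singleton b)) fun b _ => hF b

lemma measurable_finset_card [Finite β] {A : Ω → Finset β}
    (hA : ∀ b, MeasurableSet[m] {ω | b ∈ A ω}) : Measurable[m] fun ω => ((A ω).card : ℝ) := by
  classical
  have := Fintype.ofFinite β
  have hsum : (fun ω => ((A ω).card : ℝ)) = fun ω => ∑ b, if b ∈ A ω then (1 : ℝ) else 0 := by
    ext ω
    simp
  rw [hsum]
  exact Finset.measurable_fun_sum _ fun b _ =>
    Measurable.ite (hA b) measurable_const measurable_const

lemma condExp_eval_of_condLaw [IsFiniteMeasure μ] [Fintype β] {g : Ω → β} {p F : β → Ω → ℝ}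
    (hg : ∀ b, MeasurableSet[mΩ] {ω | g ω = b})
    (hp : ∀ b, μ[{ω | g ω = b}.indicator (fun _ => (1 : ℝ)) | m] =ᵐ[μ] p b)
    (hF : ∀ b, StronglyMeasurable[m] (F b)) (hFi : ∀ b, Integrable (F b) μ) :
    μ[fun ω => F (g ω) ω | m] =ᵐ[μ] fun ω => ∑ b, p b ω * F b ω := by
  classical
  set choice : β → Ω → ℝ := fun b => {ω | g ω = b}.indicator fun _ => 1
  have hchoice : ∀ b, Integrable (choice b) μ := fun b => (integrable_const _).indicator (hg b)
  have hprod : ∀ b, Integrable (F b * choice b) μ := fun b => by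
    have heq : F b * choice b = {ω | g ω = b}.indicator (F b) := by
      ext ω
      simp [choice, Set.indicator_apply]
    exact heq ▸ (hFi b).indicator (hg b)
  have hsum : (fun ω => F (g ω) ω) = ∑ b, F b * choice b := by
    ext ω
    simp [choice, Set.indicator_apply]
  rw [hsum]
  filter_upwards [condExp_finsetSum (fun b (_ : b ∈ Finset.univ) => hprod b) m, ae_all_iff.mpr
    fun b => condExp_mul_of_stronglyMeasurable_left (m := m) (hF b) (hprod b) (hchoice b),
    ae_all_iff.mpr hp] with ω hω hpull hlaw
  rw [hω, Finset.sum_apply]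
  refine Finset.sum_congr rfl fun b _ => ?_
  rw [hpull b, Pi.mul_apply, hlaw b, mul_comm]

lemma condExp_eval_of_measurable_choice {s : Finset β} {g : Ω → β} {F : β → Ω → ℝ}
    (hgs : ∀ ω, g ω ∈ s) (hm : m ≤ mΩ) (hg : ∀ b ∈ s, MeasurableSet[m] {ω | g ω = b})
    (hF : ∀ b ∈ s, Integrable (F b) μ) :
    μ[fun ω => F (g ω) ω | m] =ᵐ[μ] fun ω => (μ[F (g ω) | m]) ω := by
  classical
  have hsum : ∀ G : β → Ω → ℝ,
      (fun ω => G (g ω) ω) = ∑ b ∈ s, {ω | g ω = b}.indicator (G b) := fun G => by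
    ext ω
    simp [Set.indicator_apply, hgs ω]
  rw [hsum F, hsum fun b => μ[F b | m]]
  refine (condExp_finsetSum (fun b hb => (hF b hb).indicator (hm _ (hg b hb))) m).trans ?_
  exact eventuallyEq_sum fun b hb => condExp_indicator (hF b hb) (hg b hb)

lemma integrable_cond [NormedAddCommGroup γ] {s : Set Ω} {f : Ω → γ} (hs : μ s ≠ 0)
    (hf : Integrable f μ) : Integrable f μ[|s] :=
  hf.integrableOn.smul_measure (ENNReal.inv_ne_top.mpr hs)

lemma integral_cond_le_div [IsFiniteMeasure μ] {s : Set Ω} {f : Ω → ℝ} {B c : ℝ}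
    (hc : 0 < c) (hcs : c ≤ μ.real s) (hB : 0 ≤ B)
    (hf : ∫ ω in s, f ω ∂μ ≤ B) : ∫ ω, f ω ∂μ[|s] ≤ B / c := by
  rw [ProbabilityTheory.cond, integral_smul_measure, smul_eq_mul, ENNReal.toReal_inv,
    inv_mul_eq_div]
  exact div_le_div₀ hB hf hc hcs

end FiniteChoice

/-! ### Inverse propensity estimates -/

section InversePropensity

variable {α : Type*} {A : Finset α} {ℓ p : α → ℝ}

section Weights

variable [Fintype α]

lemma sum_mul_sub_sq_le_sum_mul_sq {f : α → ℝ} {B : ℝ} (hp : ∑ a, p a = 1)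
    (hB : ∑ a, p a * f a = B) : ∑ a, p a * (f a - B) ^ 2 ≤ ∑ a, p a * f a ^ 2 := by
  have hexpand : ∑ a, p a * (f a - B) ^ 2
      = ∑ a, p a * f a ^ 2 - 2 * B * ∑ a, p a * f a + B ^ 2 * ∑ a, p a := by
    rw [Finset.mul_sum, Finset.mul_sum, ← Finset.sum_sub_distrib, ← Finset.sum_add_distrib]
    exact Finset.sum_congr rfl fun a _ => by ring
  rw [hexpand, hB, hp]
  linarith [sq_nonneg B]

lemma sum_mul_le_add_of_one_sub_le {g : α} {ε : ℝ} (hp0 : ∀ a, 0 ≤ p a) (hp : ∑ a, p a = 1)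
    (hℓ : ∀ b, ℓ b ∈ Set.Icc (0 : ℝ) 1) (hg : 1 - ε ≤ p g) : ∑ a, p a * ℓ a ≤ ℓ g + ε := by
  classical
  rw [← Finset.add_sum_erase _ _ (Finset.mem_univ g)] at hp ⊢
  have hothers : ∑ a ∈ Finset.univ.erase g, p a * ℓ a ≤ ∑ a ∈ Finset.univ.erase g, p a :=
    Finset.sum_le_sum fun a _ => mul_le_of_le_one_right (hp0 a) (hℓ a).2
  have hgreedy : p g * ℓ g ≤ ℓ g :=
    mul_le_of_le_one_left (hℓ g).1 (le_of_add_le_of_nonneg_left hp.le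
      (Finset.sum_nonneg fun a _ => hp0 a))
  linarith

/-- `p` is a probability vector giving probability at least `η > 0` to each action of the nonempty
set `A`. -/
structure IsExploration (p : α → ℝ) (A : Finset α) (η : ℝ) : Prop where
  nonneg : ∀ a, 0 ≤ p a
  sum_eq_one : ∑ a, p a = 1
  nonempty : A.Nonempty
  pos : 0 < η
  le_of_mem : ∀ a ∈ A, η ≤ p a

lemma IsExploration.le_one {η : ℝ} (h : IsExploration p A η) : η ≤ 1 := by
  obtain ⟨a, ha⟩ := h.nonempty
  calc η ≤ p a := h.le_of_mem a ha
    _ ≤ ∑ a, p a := Finset.single_le_sum (fun a _ => h.nonneg a) (Finset.mem_univ a)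
    _ = 1 := h.sum_eq_one

end Weights

variable [DecidableEq α]

/-- The loss vector `ℓ` with the losses of the actions outside `A` replaced by the largest possible
loss `1`. -/
def pessimisticLoss (A : Finset α) (ℓ : α → ℝ) (c : α) : ℝ :=
  if c ∈ A then ℓ c else 1

/-- The inverse propensity estimate of `pessimisticLoss A ℓ c` when the action `a`, drawn with
probability `p a`, has been played. -/
noncomputable def ipsEstimate (p : α → ℝ) (A : Finset α) (ℓ : α → ℝ) (a c : α) : ℝ :=
  if c ∈ A then (if c = a then ℓ a / p a else 0) else 1

lemma pessimisticLoss_mem_Icc (hℓ : ∀ b, ℓ b ∈ Set.Icc (0 : ℝ) 1) (c : α) :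
    pessimisticLoss A ℓ c ∈ Set.Icc (0 : ℝ) 1 := by
  unfold pessimisticLoss
  split_ifs
  · exact hℓ c
  · exact ⟨zero_le_one, le_rfl⟩

lemma le_pessimisticLoss (hℓ : ∀ b, ℓ b ∈ Set.Icc (0 : ℝ) 1) (c : α) :
    ℓ c ≤ pessimisticLoss A ℓ c := by
  unfold pessimisticLoss
  split_ifs
  · exact le_rfl
  · exact (hℓ c).2

section Measurability

variable {Ω : Type*} {m : MeasurableSpace Ω} {A : Ω → Finset α} {ℓ p : Ω → α → ℝ}

lemma measurable_pessimisticLoss (hA : ∀ b, MeasurableSet {ω | b ∈ A ω})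
    (hℓ : ∀ b, Measurable fun ω => ℓ ω b) (c : α) :
    Measurable fun ω => pessimisticLoss (A ω) (ℓ ω) c :=
  Measurable.ite (hA c) (hℓ c) measurable_const

lemma measurable_ipsEstimate (hA : ∀ b, MeasurableSet {ω | b ∈ A ω})
    (hℓ : ∀ b, Measurable fun ω => ℓ ω b) (hp : ∀ b, Measurable fun ω => p ω b) (a c : α) :
    Measurable fun ω => ipsEstimate (p ω) (A ω) (ℓ ω) a c :=
  Measurable.ite (hA c) (Measurable.ite (.const _) ((hℓ a).div (hp a)) measurable_const)
    measurable_const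

end Measurability

namespace IsExploration

variable [Fintype α] {η : ℝ}

lemma ipsEstimate_mem_Icc (h : IsExploration p A η) (hℓ : ∀ b, ℓ b ∈ Set.Icc (0 : ℝ) 1)
    (a c : α) : ipsEstimate p A ℓ a c ∈ Set.Icc 0 η⁻¹ := by
  unfold ipsEstimate
  split_ifs with hc hca
  · subst hca
    refine ⟨div_nonneg (hℓ c).1 (h.nonneg c), ?_⟩
    rw [← one_div]
    exact div_le_div₀ zero_le_one (hℓ c).2 h.pos (h.le_of_mem c hc)
  · exact ⟨le_rfl, inv_nonneg.mpr h.pos.le⟩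
  · exact ⟨zero_le_one, (one_le_inv₀ h.pos).mpr h.le_one⟩

lemma sum_mul_ipsEstimate (h : IsExploration p A η) (c : α) :
    ∑ a, p a * ipsEstimate p A ℓ a c = pessimisticLoss A ℓ c := by
  unfold ipsEstimate pessimisticLoss
  by_cases hc : c ∈ A
  · have hp : p c ≠ 0 := (h.pos.trans_le (h.le_of_mem c hc)).ne'
    simp only [hc, if_true, mul_ite, mul_zero, Finset.sum_ite_eq, Finset.mem_univ]
    field_simp
  · simp only [hc, if_false, mul_one, h.sum_eq_one]

lemma sum_mul_ipsEstimate_sq_le (h : IsExploration p A η) (hℓ : ∀ b, ℓ b ∈ Set.Icc (0 : ℝ) 1)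
    (c : α) : ∑ a, p a * ipsEstimate p A ℓ a c ^ 2 ≤ η⁻¹ :=
  calc ∑ a, p a * ipsEstimate p A ℓ a c ^ 2
      ≤ ∑ a, η⁻¹ * (p a * ipsEstimate p A ℓ a c) := by
        refine Finset.sum_le_sum fun a _ => ?_
        obtain ⟨h0, h1⟩ := h.ipsEstimate_mem_Icc hℓ a c
        nlinarith [mul_le_mul_of_nonneg_left h1 (mul_nonneg (h.nonneg a) h0)]
    _ = η⁻¹ * pessimisticLoss A ℓ c := by rw [← Finset.mul_sum, h.sum_mul_ipsEstimate]
    _ ≤ η⁻¹ := mul_le_of_le_one_right (inv_nonneg.mpr h.pos.le) (pessimisticLoss_mem_Icc hℓ c).2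

lemma sum_mul_ipsEstimate_sub_sq_le (h : IsExploration p A η)
    (hℓ : ∀ b, ℓ b ∈ Set.Icc (0 : ℝ) 1) (c c' : α) :
    ∑ a, p a * (ipsEstimate p A ℓ a c - ipsEstimate p A ℓ a c'
        - (pessimisticLoss A ℓ c - pessimisticLoss A ℓ c')) ^ 2
      ≤ if c ≠ c' then 2 * η⁻¹ else 0 := by
  rcases eq_or_ne c c' with rfl | hcc
  · simp
  rw [if_pos hcc]
  have hmean : ∑ a, p a * (ipsEstimate p A ℓ a c - ipsEstimate p A ℓ a c')
      = pessimisticLoss A ℓ c - pessimisticLoss A ℓ c' := by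
    simp only [mul_sub, Finset.sum_sub_distrib, h.sum_mul_ipsEstimate]
  calc _ ≤ ∑ a, p a * (ipsEstimate p A ℓ a c - ipsEstimate p A ℓ a c') ^ 2 :=
        sum_mul_sub_sq_le_sum_mul_sq h.sum_eq_one hmean
    _ ≤ ∑ a, (p a * ipsEstimate p A ℓ a c ^ 2 + p a * ipsEstimate p A ℓ a c' ^ 2) := by
        refine Finset.sum_le_sum fun a _ => ?_
        have hcross := mul_nonneg (h.nonneg a) (mul_nonneg (h.ipsEstimate_mem_Icc hℓ a c).1
          (h.ipsEstimate_mem_Icc hℓ a c').1)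
        linarith
    _ ≤ 2 * η⁻¹ := by
        rw [Finset.sum_add_distrib, two_mul]
        exact add_le_add (h.sum_mul_ipsEstimate_sq_le hℓ c) (h.sum_mul_ipsEstimate_sq_le hℓ c')

end IsExploration

end InversePropensity

/-! ### Play probabilities, confidence terms and thresholds -/

section PlayProb

variable {K : ℕ} {ε : ℝ} {A : Finset (Fin K)} {g : Fin K}

lemma sum_playProb (hg : g ∈ A) : ∑ b, playProb ε A g b = 1 := by
  have hsplit : ∀ b, playProb ε A g b = (if b = g then 1 - (A.card : ℝ) * ε / K else 0)
      + if b ∈ A then ε / K else 0 := by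
    intro b
    unfold playProb
    by_cases hb : b = g
    · simp only [hb, if_true, hg]; ring
    · simp [hb]
  simp only [hsplit, Finset.sum_add_distrib, Finset.sum_ite_eq', Finset.mem_univ, if_true,
    Finset.sum_ite_mem, Finset.univ_inter, Finset.sum_const, nsmul_eq_mul]
  ring

lemma one_sub_add_le_playProb_self (hε : 0 ≤ ε) : 1 - ε + ε / K ≤ playProb ε A g g := by
  have hK : (0 : ℝ) < K := by exact_mod_cast Fin.pos g
  have hcard : (A.card : ℝ) ≤ K := by exact_mod_cast card_finset_fin_le A
  have hexplore : A.card * (ε / K) ≤ ε := by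
    rw [← mul_div_assoc, div_le_iff₀ hK, mul_comm]
    gcongr
  rw [playProb, if_pos rfl, sub_mul, sub_div, mul_div_assoc, one_mul]
  linarith

lemma one_sub_le_playProb_self (hε : 0 ≤ ε) : 1 - ε ≤ playProb ε A g g :=
  (le_add_of_nonneg_right (by positivity)).trans (one_sub_add_le_playProb_self hε)

lemma le_playProb (hε : ε ∈ Set.Ioc (0 : ℝ) 1) {b : Fin K} (hb : b ∈ A) :
    ε / K ≤ playProb ε A g b := by
  rcases eq_or_ne b g with rfl | hbg
  · linarith [one_sub_add_le_playProb_self (A := A) (g := b) hε.1.le, hε.2]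
  · rw [playProb, if_neg hbg, if_pos hb]

lemma playProb_nonneg (hε : ε ∈ Set.Ioc (0 : ℝ) 1) (b : Fin K) : 0 ≤ playProb ε A g b := by
  rcases eq_or_ne b g with rfl | hbg
  · exact (sub_nonneg.mpr hε.2).trans (one_sub_le_playProb_self hε.1.le)
  · have := hε.1
    rw [playProb, if_neg hbg]
    positivity

lemma isExploration_playProb (hε : ε ∈ Set.Ioc (0 : ℝ) 1) (hg : g ∈ A) :
    IsExploration (playProb ε A g) A (ε / K) where
  nonneg := playProb_nonneg hε
  sum_eq_one := sum_playProb hg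
  nonempty := ⟨g, hg⟩
  pos := div_pos hε.1 (by exact_mod_cast Fin.pos g)
  le_of_mem _ := le_playProb hε

lemma measurable_playProb {Ω : Type*} {m : MeasurableSpace Ω} {A : Ω → Finset (Fin K)}
    {g : Ω → Fin K} (hA : ∀ b, MeasurableSet {ω | b ∈ A ω}) (hg : Measurable g) (b : Fin K) :
    Measurable fun ω => playProb ε (A ω) (g ω) b := by
  have hcard := measurable_finset_card hA
  refine Measurable.ite ?_ (by fun_prop) (Measurable.ite (hA b) measurable_const measurable_const)
  simpa only [Set.preimage, Set.mem_singleton_iff, eq_comm] using hg (measurableSet_singleton b)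

end PlayProb

lemma confTerm_nonneg {N : ℕ} {δ : ℝ} (hN : 1 ≤ N) (hδ : δ ∈ Set.Ioo (0 : ℝ) 1) (T : ℕ) :
    0 ≤ confTerm N δ T := by
  rcases Nat.eq_zero_or_pos T with rfl | hT
  · simp [confTerm]
  have hT1 : (1 : ℝ) ≤ T := by exact_mod_cast hT
  have hN1 : (1 : ℝ) ≤ N := by exact_mod_cast hN
  obtain ⟨hδ0, hδ1⟩ := hδ
  refine div_nonneg (Real.log_nonneg ?_) (by positivity)
  rw [le_div_iff₀ (by positivity), one_mul, div_le_iff₀ (by positivity)]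
  nlinarith [mul_nonneg (sub_nonneg.mpr hN1) (sub_nonneg.mpr hT1), sq_nonneg (T : ℝ)]

lemma threshold_nonneg {K N : ℕ} {ε δ : ℝ} (hN : 1 ≤ N) (hδ : δ ∈ Set.Ioo (0 : ℝ) 1) (hε : 0 ≤ ε)
    (T : ℕ) : 0 ≤ threshold K N ε δ T := by
  have := confTerm_nonneg hN hδ T
  unfold threshold
  positivity

/-! ### Losses of policies -/

section PolicyLoss

variable {X : Type*} [MeasurableSpace X] {K : ℕ} {D : Measure (X × (Fin K → ℝ))}
  {π π' : X → Fin K}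

/-- The assumption `ℓ ∈ [0, 1]^K` on the law `D` of the pairs `(x, ℓ)`. -/
def HasUnitLosses (D : Measure (X × (Fin K → ℝ))) : Prop :=
  ∀ᵐ z ∂D, ∀ b, z.2 b ∈ Set.Icc (0 : ℝ) 1

lemma measurable_policy_loss (hπ : Measurable π) :
    Measurable fun z : X × (Fin K → ℝ) => z.2 (π z.1) :=
  measurable_eval (hπ.comp measurable_fst) fun b => (measurable_pi_apply b).comp measurable_snd

lemma measurableSet_policy_ne (hπ : Measurable π) (hπ' : Measurable π') :
    MeasurableSet {z : X × (Fin K → ℝ) | π z.1 ≠ π' z.1} :=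
  (measurableSet_eq_fun (hπ.comp measurable_fst) (hπ'.comp measurable_fst)).compl

lemma integral_indicator_policy_ne (hπ : Measurable π) (hπ' : Measurable π') (c : ℝ) :
    ∫ z, {z : X × (Fin K → ℝ) | π z.1 ≠ π' z.1}.indicator (fun _ => c) z ∂D
      = disagreement D π π' * c :=
  integral_indicator_const c (measurableSet_policy_ne hπ hπ')

namespace HasUnitLosses

variable [IsProbabilityMeasure D]

lemma memLp_policy_loss (hD : HasUnitLosses D) (hπ : Measurable π) (q : ENNReal) :
    MemLp (fun z : X × (Fin K → ℝ) => z.2 (π z.1)) q D :=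
  .of_bound (measurable_policy_loss hπ).aestronglyMeasurable 1 <| hD.mono fun z hz => by
    rw [Real.norm_eq_abs, abs_of_nonneg (hz _).1]
    exact (hz _).2

lemma integrable_policy_loss (hD : HasUnitLosses D) (hπ : Measurable π) :
    Integrable (fun z : X × (Fin K → ℝ) => z.2 (π z.1)) D :=
  memLp_one_iff_integrable.mp (hD.memLp_policy_loss hπ 1)

lemma expLoss_mem_Icc (hD : HasUnitLosses D) (hπ : Measurable π) :
    expLoss D π ∈ Set.Icc (0 : ℝ) 1 := by
  refine ⟨integral_nonneg_of_ae (hD.mono fun z hz => (hz _).1), ?_⟩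
  simpa [expLoss] using integral_mono_ae (hD.integrable_policy_loss hπ) (integrable_const (1 : ℝ))
    (hD.mono fun z hz => (hz (π z.1)).2)

lemma integral_policy_loss_sub_sq_le (hD : HasUnitLosses D) (hπ : Measurable π)
    (hπ' : Measurable π') :
    ∫ z, (z.2 (π z.1) - z.2 (π' z.1)) ^ 2 ∂D ≤ disagreement D π π' := by
  rw [← mul_one (disagreement D π π'), ← integral_indicator_policy_ne hπ hπ' 1]
  refine integral_mono_of_nonneg (.of_forall fun z => sq_nonneg _)
    ((integrable_const _).indicator (measurableSet_policy_ne hπ hπ')) ?_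
  filter_upwards [hD] with z hz
  by_cases hne : π z.1 = π' z.1
  · simp [hne]
  · simp only [Set.indicator_apply, Set.mem_ofPred_eq, ne_eq, hne, not_false_eq_true, if_true]
    rw [sq_le_one_iff_abs_le_one]
    exact abs_sub_le_of_nonneg_of_le (hz _).1 (hz _).2 (hz _).1 (hz _).2

lemma integrable_policy_loss_sub (hD : HasUnitLosses D) (hπ : Measurable π)
    (hπ' : Measurable π') :
    Integrable (fun z : X × (Fin K → ℝ) => z.2 (π z.1) - z.2 (π' z.1)) D :=
  (hD.integrable_policy_loss hπ).sub (hD.integrable_policy_loss hπ')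

lemma integral_policy_loss_sub (hD : HasUnitLosses D) (hπ : Measurable π)
    (hπ' : Measurable π') :
    ∫ z, (z.2 (π z.1) - z.2 (π' z.1)) ∂D = expLoss D π - expLoss D π' :=
  integral_sub (hD.integrable_policy_loss hπ) (hD.integrable_policy_loss hπ')

lemma integral_policy_loss_deviation_sq_le (hD : HasUnitLosses D) (hπ : Measurable π)
    (hπ' : Measurable π') :
    ∫ z, (z.2 (π z.1) - z.2 (π' z.1) - (expLoss D π - expLoss D π')) ^ 2 ∂D
      ≤ disagreement D π π' := by
  have hmeas : Measurable fun z : X × (Fin K → ℝ) => z.2 (π z.1) - z.2 (π' z.1) :=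
    (measurable_policy_loss hπ).sub (measurable_policy_loss hπ')
  rw [← hD.integral_policy_loss_sub hπ hπ', ← variance_eq_integral hmeas.aemeasurable]
  exact (variance_le_expectation_sq hmeas.aestronglyMeasurable).trans
    (hD.integral_policy_loss_sub_sq_le hπ hπ')

end HasUnitLosses

end PolicyLoss

/-! ### Measurability and conditional expectations of a run -/

namespace Interaction

variable {X Ω : Type*} {K : ℕ} [MeasurableSpace X] [mΩ : MeasurableSpace Ω]

/-- The information available when the action of round `t` is drawn. -/
abbrev preAct (I : Interaction X Ω K) (ℱ : Filtration ℕ mΩ) (t : ℕ) : MeasurableSpace Ω :=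
  ℱ t ⊔ MeasurableSpace.comap (fun ω => (I.x t ω, I.loss t ω)) inferInstance

section

variable (I : Interaction X Ω K) (ℱ : Filtration ℕ mΩ) (t : ℕ)

lemma le_preAct : ℱ t ≤ I.preAct ℱ t :=
  le_sup_left

lemma measurable_data_preAct : Measurable[I.preAct ℱ t] fun ω => (I.x t ω, I.loss t ω) :=
  (comap_measurable _).mono le_sup_right le_rfl

lemma measurable_policy_preAct {π : X → Fin K} (hπ : Measurable π) :
    Measurable[I.preAct ℱ t] fun ω => π (I.x t ω) :=
  hπ.comp (measurable_fst.comp (I.measurable_data_preAct ℱ t))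

lemma measurable_loss_preAct (b : Fin K) : Measurable[I.preAct ℱ t] fun ω => I.loss t ω b :=
  (measurable_pi_apply b).comp (measurable_snd.comp (I.measurable_data_preAct ℱ t))

end

namespace IsRun

variable {I : Interaction X Ω K} {ℱ : Filtration ℕ mΩ} {μ : Measure Ω}
  {D : Measure (X × (Fin K → ℝ))} {P : Finset (X → Fin K)} {ε δ : ℝ} {π : X → Fin K}

lemma measurable_data_succ (h : I.IsRun ℱ μ D P ε δ) (t : ℕ) :
    Measurable[ℱ (t + 1)] fun ω => (I.x t ω, I.loss t ω) :=
  (h.measurable_x t).prodMk (h.measurable_loss t)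

lemma measurable_data (h : I.IsRun ℱ μ D P ε δ) (t : ℕ) :
    Measurable fun ω => (I.x t ω, I.loss t ω) :=
  (h.measurable_data_succ t).mono (ℱ.le _) le_rfl

lemma preAct_le_succ (h : I.IsRun ℱ μ D P ε δ) (t : ℕ) : I.preAct ℱ t ≤ ℱ (t + 1) :=
  sup_le (ℱ.mono (Nat.le_succ t)) (h.measurable_data_succ t).comap_le

lemma preAct_le (h : I.IsRun ℱ μ D P ε δ) (t : ℕ) : I.preAct ℱ t ≤ mΩ :=
  (h.preAct_le_succ t).trans (ℱ.le _)

lemma card_pos (h : I.IsRun ℱ μ D P ε δ) (ω : Ω) : 1 ≤ P.card :=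
  Finset.card_pos.mpr ⟨_, h.greedy_mem 0 ω⟩

lemma measurable_greedyAction (h : I.IsRun ℱ μ D P ε δ) (hP : ∀ π ∈ P, Measurable π) (t : ℕ) :
    Measurable[I.preAct ℱ t] fun ω => I.greedy t ω (I.x t ω) :=
  measurable_eval_of_mem_finset (F := fun π ω => π (I.x t ω)) (h.greedy_mem t)
    (fun π hπ => I.le_preAct ℱ t _ (h.measurable_greedy t π hπ))
    fun π hπ => I.measurable_policy_preAct ℱ t (hP π hπ)

lemma measurable_ipsEstimate_of_measurableSet_explored (h : I.IsRun ℱ μ D P ε δ)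
    (hP : ∀ π ∈ P, Measurable π) {t : ℕ}
    (hA : ∀ b, MeasurableSet[I.preAct ℱ t] {ω | b ∈ I.explored t ω}) (hπ : Measurable π)
    (a : Fin K) : Measurable[I.preAct ℱ t] fun ω =>
      ipsEstimate (I.prob ε t ω) (I.explored t ω) (I.loss t ω) a (π (I.x t ω)) :=
  measurable_eval (I.measurable_policy_preAct ℱ t hπ) fun c =>
    measurable_ipsEstimate hA (I.measurable_loss_preAct ℱ t)
      (measurable_playProb hA (h.measurable_greedyAction hP t)) a c

lemma measurable_ipsEmp_of_measurableSet_explored (h : I.IsRun ℱ μ D P ε δ)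
    (hP : ∀ π ∈ P, Measurable π) {t : ℕ}
    (hA : ∀ s < t, ∀ b, MeasurableSet[I.preAct ℱ s] {ω | b ∈ I.explored s ω})
    (hπ : Measurable π) : Measurable[ℱ t] fun ω => I.ipsEmp ε t ω π := by
  refine Measurable.div_const (Finset.measurable_fun_sum _ fun s hs => ?_) _
  have hst := Finset.mem_range.mp hs
  have hround : Measurable[ℱ (s + 1)] fun ω => I.ipsLoss ε s ω (π (I.x s ω)) :=
    measurable_eval (h.measurable_act s) fun a =>
      (h.measurable_ipsEstimate_of_measurableSet_explored hP (hA s hst) hπ a).mono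
        (h.preAct_le_succ s) le_rfl
  exact hround.mono (ℱ.mono hst) le_rfl

lemma measurableSet_explored_of_measurable_ipsEmp (h : I.IsRun ℱ μ D P ε δ)
    (hP : ∀ π ∈ P, Measurable π) {t : ℕ} (ht : 1 ≤ t)
    (hE : ∀ π ∈ P, Measurable[ℱ t] fun ω => I.ipsEmp ε t ω π) (b : Fin K) :
    MeasurableSet[I.preAct ℱ t] {ω | b ∈ I.explored t ω} := by
  have hcover : {ω | b ∈ I.explored t ω} = ⋃ π ∈ P, (fun ω => π (I.x t ω)) ⁻¹' {b} ∩
      {ω | I.ipsEmp ε t ω π - I.ipsEmp ε t ω (I.greedy t ω) ≤ threshold K P.card ε δ t} := by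
    ext ω
    simp only [Set.mem_ofPred_eq, h.mem_explored t ht ω b, Set.mem_iUnion, Set.mem_inter_iff,
      Set.mem_preimage, Set.mem_singleton_iff, exists_prop]
  have hgreedy : Measurable[ℱ t] fun ω => I.ipsEmp ε t ω (I.greedy t ω) :=
    measurable_eval_of_mem_finset (F := fun π ω => I.ipsEmp ε t ω π) (h.greedy_mem t)
      (h.measurable_greedy t) hE
  rw [hcover]
  exact .biUnion P.countable_toSet fun π hπ =>
    (I.measurable_policy_preAct ℱ t (hP π hπ) (measurableSet_singleton b)).inter
      (I.le_preAct ℱ t _ (measurableSet_le ((hE π hπ).sub hgreedy) measurable_const))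

lemma measurableSet_explored (h : I.IsRun ℱ μ D P ε δ) (hP : ∀ π ∈ P, Measurable π) (t : ℕ) :
    ∀ b, MeasurableSet[I.preAct ℱ t] {ω | b ∈ I.explored t ω} := by
  induction t using Nat.strong_induction_on with
  | _ t ih =>
    rcases Nat.eq_zero_or_pos t with rfl | ht
    · simp [h.explored_zero]
    · exact h.measurableSet_explored_of_measurable_ipsEmp hP ht fun π hπ =>
        h.measurable_ipsEmp_of_measurableSet_explored hP ih (hP π hπ)

lemma measurable_policy_trueLoss (h : I.IsRun ℱ μ D P ε δ) (hπ : Measurable π) (t : ℕ) :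
    Measurable[ℱ (t + 1)] fun ω => I.loss t ω (π (I.x t ω)) :=
  (measurable_policy_loss hπ).comp (h.measurable_data_succ t)

lemma greedy_mem_explored (h : I.IsRun ℱ μ D P ε δ) (hδ : δ ∈ Set.Ioo (0 : ℝ) 1)
    (hε : 0 ≤ ε) (t : ℕ) (ω : Ω) : I.greedy t ω (I.x t ω) ∈ I.explored t ω := by
  rcases Nat.eq_zero_or_pos t with rfl | ht
  · simp [h.explored_zero]
  · rw [h.mem_explored t ht]
    refine ⟨_, h.greedy_mem t ω, rfl, ?_⟩
    rw [sub_self]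
    exact threshold_nonneg (h.card_pos ω) hδ hε t

lemma isExploration_prob (h : I.IsRun ℱ μ D P ε δ) (hδ : δ ∈ Set.Ioo (0 : ℝ) 1)
    (hε : ε ∈ Set.Ioc (0 : ℝ) 1) (t : ℕ) (ω : Ω) :
    IsExploration (I.prob ε t ω) (I.explored t ω) (ε / K) :=
  isExploration_playProb hε (h.greedy_mem_explored hδ hε.1.le t ω)

lemma ae_loss_mem_Icc (h : I.IsRun ℱ μ D P ε δ) (hD : HasUnitLosses D) :
    ∀ᵐ ω ∂μ, ∀ t b, I.loss t ω b ∈ Set.Icc (0 : ℝ) 1 := by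
  refine ae_all_iff.mpr fun t => ?_
  rw [HasUnitLosses, ← h.law t] at hD
  exact ae_of_ae_map (h.measurable_data t).aemeasurable hD

variable [IsProbabilityMeasure μ]

lemma condExp_act (h : I.IsRun ℱ μ D P ε δ) {t : ℕ} {F : Fin K → Ω → ℝ} {C : ℝ}
    (hF : ∀ b, Measurable[I.preAct ℱ t] (F b)) (hC : ∀ᵐ ω ∂μ, ∀ b, |F b ω| ≤ C) :
    μ[fun ω => F (I.act t ω) ω | I.preAct ℱ t] =ᵐ[μ] fun ω => ∑ b, I.prob ε t ω b * F b ω :=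
  condExp_eval_of_condLaw
    (fun b => (h.measurable_act t).mono (ℱ.le _) le_rfl (measurableSet_singleton b))
    (h.act_law t) (fun b => (hF b).stronglyMeasurable) fun b =>
      .of_bound ((hF b).mono (h.preAct_le t) le_rfl).aestronglyMeasurable C
        (hC.mono fun _ hω => hω b)

lemma condExp_data (h : I.IsRun ℱ μ D P ε δ) (t : ℕ) {f : X × (Fin K → ℝ) → ℝ}
    (hf : Measurable f) :
    μ[fun ω => f (I.x t ω, I.loss t ω) | ℱ t] =ᵐ[μ] fun _ => ∫ z, f z ∂D := by
  have hlaw : ∫ ω, f (I.x t ω, I.loss t ω) ∂μ = ∫ z, f z ∂D := by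
    rw [← h.law t, integral_map (h.measurable_data t).aemeasurable hf.aestronglyMeasurable]
  rw [← hlaw]
  exact condExp_indep_eq (h.measurable_data t).comap_le (ℱ.le t)
    (hf.comp (comap_measurable _)).stronglyMeasurable (h.indep t)

end IsRun

end Interaction

/-! ### The deviation processes -/

namespace Interaction

section

variable {X Ω : Type*} {K : ℕ}

/-- The error, in round `t`, of the estimate of the biased loss difference between `π` and `π'`
when the action `a` is played. -/
noncomputable def ipsDeviation (I : Interaction X Ω K) (ε : ℝ) (π π' : X → Fin K) (t : ℕ)
    (a : Fin K) (ω : Ω) : ℝ :=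
  ipsEstimate (I.prob ε t ω) (I.explored t ω) (I.loss t ω) a (π (I.x t ω))
      - ipsEstimate (I.prob ε t ω) (I.explored t ω) (I.loss t ω) a (π' (I.x t ω))
    - (I.biasedLoss t ω (π (I.x t ω)) - I.biasedLoss t ω (π' (I.x t ω)))

/-- The deviation, in round `t`, of the loss difference between `π` and `π'` from its mean. -/
noncomputable def lossDeviation [MeasurableSpace X] (I : Interaction X Ω K)
    (D : Measure (X × (Fin K → ℝ))) (π π' : X → Fin K) (t : ℕ) (ω : Ω) : ℝ :=
  I.loss t ω (π (I.x t ω)) - I.loss t ω (π' (I.x t ω)) - (expLoss D π - expLoss D π')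

lemma sum_ipsDeviation_div (I : Interaction X Ω K) (ε : ℝ) (π π' : X → Fin K) (T : ℕ) (ω : Ω) :
    (∑ t ∈ Finset.range T, I.ipsDeviation ε π π' t (I.act t ω) ω) / T
      = (I.ipsEmp ε T ω π - I.ipsEmp ε T ω π') - (I.biasedEmp T ω π - I.biasedEmp T ω π') := by
  simp only [ipsDeviation, Finset.sum_sub_distrib, sub_div]
  rfl

lemma sum_lossDeviation_div [MeasurableSpace X] (I : Interaction X Ω K)
    (D : Measure (X × (Fin K → ℝ))) (π π' : X → Fin K) {T : ℕ} (hT : 1 ≤ T) (ω : Ω) :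
    (∑ t ∈ Finset.range T, I.lossDeviation D π π' t ω) / T
      = (I.trueEmp T ω π - I.trueEmp T ω π') - (expLoss D π - expLoss D π') := by
  have hT0 : (T : ℝ) ≠ 0 := by positivity
  simp only [lossDeviation, trueEmp, empLoss, Finset.sum_sub_distrib, Finset.sum_const,
    Finset.card_range, nsmul_eq_mul]
  field_simp

end

namespace IsRun

variable {X Ω : Type*} {K : ℕ} [MeasurableSpace X] [mΩ : MeasurableSpace Ω]
  {I : Interaction X Ω K} {ℱ : Filtration ℕ mΩ} {μ : Measure Ω} {D : Measure (X × (Fin K → ℝ))}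
  {P : Finset (X → Fin K)} {ε δ : ℝ} {π π' : X → Fin K}

lemma measurable_ipsDeviation (h : I.IsRun ℱ μ D P ε δ) (hP : ∀ π ∈ P, Measurable π)
    (hπ : Measurable π) (hπ' : Measurable π') (t : ℕ) (a : Fin K) :
    Measurable[I.preAct ℱ t] (I.ipsDeviation ε π π' t a) := by
  have hA := h.measurableSet_explored hP t
  have hips := fun {π : X → Fin K} (hπ : Measurable π) =>
    h.measurable_ipsEstimate_of_measurableSet_explored hP hA hπ a
  have hbiased : ∀ {π : X → Fin K}, Measurable π →
      Measurable[I.preAct ℱ t] fun ω => I.biasedLoss t ω (π (I.x t ω)) := fun hπ =>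
    measurable_eval (I.measurable_policy_preAct ℱ t hπ)
      (measurable_pessimisticLoss hA (I.measurable_loss_preAct ℱ t))
  exact ((hips hπ).sub (hips hπ')).sub ((hbiased hπ).sub (hbiased hπ'))

lemma ae_abs_ipsDeviation_le (h : I.IsRun ℱ μ D P ε δ) (hD : HasUnitLosses D)
    (hδ : δ ∈ Set.Ioo (0 : ℝ) 1) (hε : ε ∈ Set.Ioc (0 : ℝ) 1) (t : ℕ) :
    ∀ᵐ ω ∂μ, ∀ a, |I.ipsDeviation ε π π' t a ω| ≤ K / ε + 1 := by
  filter_upwards [h.ae_loss_mem_Icc hD] with ω hℓ a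
  have hprob := h.isExploration_prob hδ hε t ω
  have hest := fun c => hprob.ipsEstimate_mem_Icc (hℓ t) a c
  simp only [inv_div] at hest
  refine (abs_sub _ _).trans (add_le_add ?_ ?_)
  · exact abs_sub_le_of_nonneg_of_le (hest _).1 (hest _).2 (hest _).1 (hest _).2
  · have hbiased := fun c => pessimisticLoss_mem_Icc (A := I.explored t ω) (hℓ t) c
    exact abs_sub_le_of_nonneg_of_le (hbiased _).1 (hbiased _).2 (hbiased _).1 (hbiased _).2

variable [IsProbabilityMeasure μ]

lemma condExp_ipsDeviation (h : I.IsRun ℱ μ D P ε δ) (hP : ∀ π ∈ P, Measurable π)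
    (hD : HasUnitLosses D) (hδ : δ ∈ Set.Ioo (0 : ℝ) 1) (hε : ε ∈ Set.Ioc (0 : ℝ) 1)
    (hπ : Measurable π) (hπ' : Measurable π') (t : ℕ) :
    μ[fun ω => I.ipsDeviation ε π π' t (I.act t ω) ω | ℱ t] =ᵐ[μ] 0 := by
  have hunbiased :
      μ[fun ω => I.ipsDeviation ε π π' t (I.act t ω) ω | I.preAct ℱ t] =ᵐ[μ] 0 := by
    refine (h.condExp_act (h.measurable_ipsDeviation hP hπ hπ' t)
      (h.ae_abs_ipsDeviation_le hD hδ hε t)).trans (.of_forall fun ω => ?_)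
    have hprob := h.isExploration_prob hδ hε t ω
    simp only [ipsDeviation, mul_sub, Finset.sum_sub_distrib, hprob.sum_mul_ipsEstimate,
      ← Finset.sum_mul, hprob.sum_eq_one, one_mul]
    exact sub_self _
  refine (condExp_condExp_of_le (I.le_preAct ℱ t) (h.preAct_le t)).symm.trans ?_
  rw [← condExp_zero (μ := μ) (m := ℱ t)]
  exact condExp_congr_ae hunbiased

lemma condExp_preAct_ipsDeviation_sq_le (h : I.IsRun ℱ μ D P ε δ) (hP : ∀ π ∈ P, Measurable π)
    (hD : HasUnitLosses D) (hδ : δ ∈ Set.Ioo (0 : ℝ) 1) (hε : ε ∈ Set.Ioc (0 : ℝ) 1)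
    (hπ : Measurable π) (hπ' : Measurable π') (t : ℕ) :
    μ[fun ω => I.ipsDeviation ε π π' t (I.act t ω) ω ^ 2 | I.preAct ℱ t]
      ≤ᵐ[μ] fun ω => {z | π z.1 ≠ π' z.1}.indicator (fun _ => 2 * (ε / K)⁻¹)
        (I.x t ω, I.loss t ω) := by
  have hbound : ∀ᵐ ω ∂μ, ∀ a, |I.ipsDeviation ε π π' t a ω ^ 2| ≤ (K / ε + 1) ^ 2 := by
    filter_upwards [h.ae_abs_ipsDeviation_le hD hδ hε t] with ω hω a
    rw [abs_pow]
    exact pow_le_pow_left₀ (abs_nonneg _) (hω a) 2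
  have hact := h.condExp_act (F := fun a ω => I.ipsDeviation ε π π' t a ω ^ 2)
    (fun a => (h.measurable_ipsDeviation hP hπ hπ' t a).pow_const 2) hbound
  filter_upwards [hact, h.ae_loss_mem_Icc hD] with ω hω hℓ
  refine hω.le.trans (((h.isExploration_prob hδ hε t ω).sum_mul_ipsEstimate_sub_sq_le (hℓ t)
    (π (I.x t ω)) (π' (I.x t ω))).trans_eq ?_)
  simp only [Set.indicator_apply, Set.mem_ofPred_eq]

lemma condExp_ipsDeviation_sq_le (h : I.IsRun ℱ μ D P ε δ) (hP : ∀ π ∈ P, Measurable π)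
    (hD : HasUnitLosses D) (hδ : δ ∈ Set.Ioo (0 : ℝ) 1) (hε : ε ∈ Set.Ioc (0 : ℝ) 1)
    (hπ : Measurable π) (hπ' : Measurable π') (t : ℕ) :
    μ[fun ω => I.ipsDeviation ε π π' t (I.act t ω) ω ^ 2 | ℱ t]
      ≤ᵐ[μ] fun _ => 2 * K * disagreement D π π' / ε := by
  set f : X × (Fin K → ℝ) → ℝ := {z | π z.1 ≠ π' z.1}.indicator fun _ => 2 * (ε / K)⁻¹ with hf
  have hfm : Measurable f := measurable_const.indicator (measurableSet_policy_ne hπ hπ')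
  have hmean : ∫ z, f z ∂D = 2 * K * disagreement D π π' / ε := by
    rw [hf, integral_indicator_policy_ne hπ hπ', inv_div]
    ring
  have hint : Integrable (fun ω => f (I.x t ω, I.loss t ω)) μ :=
    (integrable_const _).indicator (h.measurable_data t (measurableSet_policy_ne hπ hπ'))
  filter_upwards [condExp_mono (m := ℱ t) integrable_condExp hint
      (h.condExp_preAct_ipsDeviation_sq_le hP hD hδ hε hπ hπ' t), h.condExp_data t hfm,
    condExp_condExp_of_le (μ := μ) (f := fun ω => I.ipsDeviation ε π π' t (I.act t ω) ω ^ 2)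
      (I.le_preAct ℱ t) (h.preAct_le t)] with ω hmono hdata htower
  rwa [htower, hdata, hmean] at hmono

lemma isMartingaleDifference_ipsDeviation (h : I.IsRun ℱ μ D P ε δ)
    (hP : ∀ π ∈ P, Measurable π) (hD : HasUnitLosses D) (hδ : δ ∈ Set.Ioo (0 : ℝ) 1)
    (hε : ε ∈ Set.Ioc (0 : ℝ) 1) (hπ : Measurable π) (hπ' : Measurable π') :
    IsMartingaleDifference (fun t ω => I.ipsDeviation ε π π' t (I.act t ω) ω) ℱ μ
      (K / ε + 1) where
  measurable t := measurable_eval (h.measurable_act t) fun a =>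
    (h.measurable_ipsDeviation hP hπ hπ' t a).mono (h.preAct_le_succ t) le_rfl
  abs_le t := (h.ae_abs_ipsDeviation_le hD hδ hε t).mono fun ω hω => hω (I.act t ω)
  condExp_eq_zero := h.condExp_ipsDeviation hP hD hδ hε hπ hπ'

variable [IsProbabilityMeasure D]

lemma isMartingaleDifference_lossDeviation (h : I.IsRun ℱ μ D P ε δ) (hD : HasUnitLosses D)
    (hπ : Measurable π) (hπ' : Measurable π') :
    IsMartingaleDifference (I.lossDeviation D π π') ℱ μ 2 where
  measurable t := ((h.measurable_policy_trueLoss hπ t).sub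
    (h.measurable_policy_trueLoss hπ' t)).sub measurable_const
  abs_le t := by
    filter_upwards [h.ae_loss_mem_Icc hD] with ω hℓ
    refine ((abs_sub _ _).trans (add_le_add ?_ ?_)).trans one_add_one_eq_two.le
    · exact abs_sub_le_of_nonneg_of_le (hℓ t _).1 (hℓ t _).2 (hℓ t _).1 (hℓ t _).2
    · have hL := hD.expLoss_mem_Icc hπ
      have hL' := hD.expLoss_mem_Icc hπ'
      exact abs_sub_le_of_nonneg_of_le hL.1 hL.2 hL'.1 hL'.2
  condExp_eq_zero t := by
    have hzero :
        ∫ z, (z.2 (π z.1) - z.2 (π' z.1) - (expLoss D π - expLoss D π')) ∂D = 0 := by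
      rw [integral_sub (hD.integrable_policy_loss_sub hπ hπ') (integrable_const _),
        hD.integral_policy_loss_sub hπ hπ', integral_const, probReal_univ, one_smul, sub_self]
    exact (h.condExp_data t (((measurable_policy_loss hπ).sub
      (measurable_policy_loss hπ')).sub measurable_const)).trans (.of_forall fun _ => hzero)

lemma condExp_lossDeviation_sq_le (h : I.IsRun ℱ μ D P ε δ) (hD : HasUnitLosses D)
    (hπ : Measurable π) (hπ' : Measurable π') (t : ℕ) :
    μ[fun ω => I.lossDeviation D π π' t ω ^ 2 | ℱ t] ≤ᵐ[μ] fun _ => disagreement D π π' :=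
  (h.condExp_data t ((((measurable_policy_loss hπ).sub
    (measurable_policy_loss hπ')).sub measurable_const).pow_const 2)).le.trans
      (.of_forall fun _ => hD.integral_policy_loss_deviation_sq_le hπ hπ')

end IsRun

end Interaction

/-! ### The probability of the deviation event -/

lemma hasSum_div_sq_add_succ (c : ℝ) :
    HasSum (fun n : ℕ => c / (((n + 1 : ℕ) : ℝ) ^ 2 + (n + 1 : ℕ))) c := by
  suffices hone : HasSum (fun n : ℕ => 1 / (((n + 1 : ℕ) : ℝ) ^ 2 + (n + 1 : ℕ))) 1 by
    simpa only [mul_one_div, mul_one] using hone.mul_left c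
  have hpartial : ∀ n : ℕ, ∑ i ∈ Finset.range n, 1 / (((i + 1 : ℕ) : ℝ) ^ 2 + (i + 1 : ℕ))
      = 1 - 1 / ((n : ℝ) + 1) := by
    intro n
    induction n with
    | zero => simp
    | succ n ih =>
      rw [Finset.sum_range_succ, ih]
      push_cast
      field_simp
      ring
  rw [hasSum_iff_tendsto_nat_of_nonneg fun n => by positivity]
  simpa only [hpartial, sub_zero] using
    (tendsto_one_div_add_atTop_nhds_zero_nat (𝕜 := ℝ)).const_sub 1

lemma exp_neg_two_mul_confTerm {N : ℕ} {δ : ℝ} (hN : 1 ≤ N) (hδ : 0 < δ) {T : ℕ} (hT : 1 ≤ T) :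
    Real.exp (-(2 * (T * confTerm N δ T))) = (δ / ((T : ℝ) ^ 2 + T) / (2 * N)) ^ 2 := by
  have hT0 : (0 : ℝ) < T := by exact_mod_cast hT
  have : (0 : ℝ) < N := by exact_mod_cast hN
  rw [confTerm, mul_div_cancel₀ _ hT0.ne', ← mul_neg, ← Real.log_inv, inv_div, two_mul,
    Real.exp_add, Real.exp_log (by positivity), ← sq]

namespace Interaction

variable {X Ω : Type*} {K : ℕ} [MeasurableSpace X]

/-- The event that one of the two deviation bounds fails for the policy `π` after `T` rounds. -/
def deviationFailure (I : Interaction X Ω K) (D : Measure (X × (Fin K → ℝ)))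
    (P : Finset (X → Fin K)) (πstar : X → Fin K) (ε δ : ℝ) (T : ℕ) (π : X → Fin K) : Set Ω :=
  {ω | 2 * √(2 * K * disagreement D π πstar * confTerm P.card δ T / ε)
      + (K / ε + 1) * confTerm P.card δ T
    < |(I.ipsEmp ε T ω π - I.ipsEmp ε T ω πstar) - (I.biasedEmp T ω π - I.biasedEmp T ω πstar)|}
  ∪ {ω | 2 * √(disagreement D π πstar * confTerm P.card δ T) + 2 * confTerm P.card δ T
    < |(I.trueEmp T ω π - I.trueEmp T ω πstar) - (expLoss D π - expLoss D πstar)|}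

lemma compl_deviationEvent (I : Interaction X Ω K) (D : Measure (X × (Fin K → ℝ)))
    (P : Finset (X → Fin K)) (πstar : X → Fin K) (ε δ : ℝ) :
    (I.deviationEvent D P πstar ε δ)ᶜ
      = ⋃ n : ℕ, ⋃ π ∈ P, I.deviationFailure D P πstar ε δ (n + 1) π := by
  rw [compl_eq_comm]
  ext ω
  simp only [deviationEvent, deviationFailure, Set.mem_compl_iff, Set.mem_iUnion, Set.mem_union,
    Set.mem_ofPred_eq, not_exists, not_or, not_lt]
  constructor
  · intro h π hπ T hT
    obtain ⟨n, rfl⟩ := Nat.exists_eq_add_of_le' hT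
    exact h n π hπ
  · intro h n π hπ
    exact h π hπ (n + 1) (Nat.le_add_left 1 n)

namespace IsRun

variable [mΩ : MeasurableSpace Ω] {I : Interaction X Ω K} {ℱ : Filtration ℕ mΩ} {μ : Measure Ω}
  {D : Measure (X × (Fin K → ℝ))} {P : Finset (X → Fin K)} {ε δ : ℝ} {π πstar : X → Fin K}
  [IsProbabilityMeasure μ] [IsProbabilityMeasure D]

lemma measurableSet_deviationEvent (h : I.IsRun ℱ μ D P ε δ) (hP : ∀ π ∈ P, Measurable π)
    (hD : HasUnitLosses D) (hδ : δ ∈ Set.Ioo (0 : ℝ) 1) (hε : ε ∈ Set.Ioc (0 : ℝ) 1)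
    (hstar : πstar ∈ P) : MeasurableSet (I.deviationEvent D P πstar ε δ) := by
  refine .of_compl ?_
  rw [compl_deviationEvent]
  refine .iUnion fun n => .biUnion P.countable_toSet fun π hπ => ?_
  simp only [deviationFailure, ← sum_ipsDeviation_div,
    ← sum_lossDeviation_div I D _ _ (Nat.le_add_left 1 n)]
  have hips := (h.isMartingaleDifference_ipsDeviation hP hD hδ hε (hP π hπ)
    (hP _ hstar)).measurable_sum (n + 1)
  have hloss := (h.isMartingaleDifference_lossDeviation hD (hP π hπ)
    (hP _ hstar)).measurable_sum (n + 1)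
  exact (measurableSet_lt measurable_const ((hips.mono (ℱ.le _) le_rfl).div_const _).abs).union
    (measurableSet_lt measurable_const ((hloss.mono (ℱ.le _) le_rfl).div_const _).abs)

lemma measureReal_deviationFailure_le (h : I.IsRun ℱ μ D P ε δ) (hP : ∀ π ∈ P, Measurable π)
    (hD : HasUnitLosses D) (hδ : δ ∈ Set.Ioo (0 : ℝ) 1) (hε : ε ∈ Set.Ioc (0 : ℝ) 1)
    (hstar : πstar ∈ P) (hπ : π ∈ P) {T : ℕ} (hT : 1 ≤ T) :
    μ.real (I.deviationFailure D P πstar ε δ T π)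
      ≤ 4 * (δ / ((T : ℝ) ^ 2 + T) / (2 * P.card)) ^ 2 := by
  have hN : 1 ≤ P.card := Finset.card_pos.mpr ⟨π, hπ⟩
  have hε0 := hε.1
  have he := confTerm_nonneg hN hδ T
  have hρ : 0 ≤ disagreement D π πstar := measureReal_nonneg
  have hips := (h.isMartingaleDifference_ipsDeviation hP hD hδ hε (hP π hπ)
    (hP _ hstar)).measureReal_lt_abs_average_le
      (h.condExp_ipsDeviation_sq_le hP hD hδ hε (hP π hπ) (hP _ hstar))
      (by positivity) (by positivity) he hT
  have hloss := (h.isMartingaleDifference_lossDeviation hD (hP π hπ)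
    (hP _ hstar)).measureReal_lt_abs_average_le
      (h.condExp_lossDeviation_sq_le hD (hP π hπ) (hP _ hstar)) hρ two_pos he hT
  rw [exp_neg_two_mul_confTerm hN hδ.1 hT] at hips hloss
  simp only [sum_ipsDeviation_div, sum_lossDeviation_div I D _ _ hT, div_mul_eq_mul_div]
    at hips hloss
  exact (measureReal_union_le _ _).trans (by linarith)

lemma measure_biUnion_deviationFailure_le (h : I.IsRun ℱ μ D P ε δ)
    (hP : ∀ π ∈ P, Measurable π) (hD : HasUnitLosses D) (hδ : δ ∈ Set.Ioo (0 : ℝ) 1)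
    (hε : ε ∈ Set.Ioc (0 : ℝ) 1) (hstar : πstar ∈ P) {T : ℕ} (hT : 1 ≤ T) :
    μ (⋃ π ∈ P, I.deviationFailure D P πstar ε δ T π)
      ≤ ENNReal.ofReal (δ / 2 / ((T : ℝ) ^ 2 + T)) := by
  have hN : (1 : ℝ) ≤ P.card := by exact_mod_cast Finset.card_pos.mpr ⟨_, hstar⟩
  have hδ0 := hδ.1
  have hT1 : (1 : ℝ) ≤ T := by exact_mod_cast hT
  rw [ENNReal.le_ofReal_iff_toReal_le (measure_ne_top _ _) (by positivity)]
  have htwo : (2 : ℝ) ≤ (T : ℝ) ^ 2 + T := by nlinarith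
  set y := (T : ℝ) ^ 2 + T
  calc μ.real (⋃ π ∈ P, I.deviationFailure D P πstar ε δ T π)
      ≤ ∑ π ∈ P, μ.real (I.deviationFailure D P πstar ε δ T π) :=
        measureReal_biUnion_finset_le _ _
    _ ≤ ∑ _π ∈ P, 4 * (δ / y / (2 * P.card)) ^ 2 :=
        Finset.sum_le_sum fun π hπ => h.measureReal_deviationFailure_le hP hD hδ hε hstar hπ hT
    _ = (δ / y) * (δ / y) / P.card := by rw [Finset.sum_const, nsmul_eq_mul]; field_simp; ring
    _ ≤ (δ / y) * (δ / y) := div_le_self (by positivity) hN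
    _ ≤ (δ / y) * (1 / 2) := by
        gcongr
        exacts [hδ.2.le]
    _ = δ / 2 / y := by ring

theorem one_sub_half_le_measureReal_deviationEvent (h : I.IsRun ℱ μ D P ε δ)
    (hP : ∀ π ∈ P, Measurable π) (hD : HasUnitLosses D) (hδ : δ ∈ Set.Ioo (0 : ℝ) 1)
    (hε : ε ∈ Set.Ioc (0 : ℝ) 1) (hstar : πstar ∈ P) :
    1 - δ / 2 ≤ μ.real (I.deviationEvent D P πstar ε δ) := by
  have hδ0 := hδ.1
  have hbudget := hasSum_div_sq_add_succ (δ / 2)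
  have hcompl : μ (I.deviationEvent D P πstar ε δ)ᶜ ≤ ENNReal.ofReal (δ / 2) := by
    rw [compl_deviationEvent]
    calc μ (⋃ n : ℕ, ⋃ π ∈ P, I.deviationFailure D P πstar ε δ (n + 1) π)
        ≤ ∑' n : ℕ, μ (⋃ π ∈ P, I.deviationFailure D P πstar ε δ (n + 1) π) :=
          measure_iUnion_le _
      _ ≤ ∑' n : ℕ, ENNReal.ofReal (δ / 2 / (((n + 1 : ℕ) : ℝ) ^ 2 + (n + 1 : ℕ))) :=
          ENNReal.tsum_le_tsum fun n =>
            h.measure_biUnion_deviationFailure_le hP hD hδ hε hstar (Nat.le_add_left 1 n)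
      _ = ENNReal.ofReal (δ / 2) := by
          rw [← ENNReal.ofReal_tsum_of_nonneg (fun n => by positivity) hbudget.summable,
            hbudget.tsum_eq]
  have hreal : μ.real (I.deviationEvent D P πstar ε δ)ᶜ ≤ δ / 2 :=
    ENNReal.toReal_le_of_le_ofReal (by positivity) hcompl
  rw [probReal_compl_eq_one_sub (h.measurableSet_deviationEvent hP hD hδ hε hstar)] at hreal
  linarith

lemma measure_deviationEvent_ne_zero (h : I.IsRun ℱ μ D P ε δ) (hP : ∀ π ∈ P, Measurable π)
    (hD : HasUnitLosses D) (hδ : δ ∈ Set.Ioo (0 : ℝ) 1) (hε : ε ∈ Set.Ioc (0 : ℝ) 1)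
    (hstar : πstar ∈ P) : μ (I.deviationEvent D P πstar ε δ) ≠ 0 := fun hzero => by
  have hhalf := h.one_sub_half_le_measureReal_deviationEvent hP hD hδ hε hstar
  rw [measureReal_def, hzero, ENNReal.toReal_zero] at hhalf
  linarith [hδ.2]

end IsRun

end Interaction

/-! ### The gap of the greedy policy -/

lemma deviation_bounds_le_threshold {K N : ℕ} {ε δ ρ : ℝ} {T : ℕ} (hε : 0 ≤ ε)
    (hρ : ρ ≤ 1) (he : 0 ≤ confTerm N δ T) :
    2 * √(2 * K * ρ * confTerm N δ T / ε) + (K / ε + 1) * confTerm N δ T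
      + (2 * √(ρ * confTerm N δ T) + 2 * confTerm N δ T) ≤ threshold K N ε δ T := by
  unfold threshold
  set e := confTerm N δ T
  have hips : √(2 * K * ρ * e / ε) ≤ √(2 * K / ε) * √e := by
    rw [← Real.sqrt_mul (by positivity)]
    refine Real.sqrt_le_sqrt ?_
    calc 2 * K * ρ * e / ε = ρ * (2 * K / ε * e) := by ring
      _ ≤ 2 * K / ε * e := mul_le_of_le_one_left (by positivity) hρ
  have hloss : √(ρ * e) ≤ √e := Real.sqrt_le_sqrt (mul_le_of_le_one_left he hρ)
  linarith

namespace Interaction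

variable {X Ω : Type*} {K : ℕ} {I : Interaction X Ω K} {ω : Ω}

lemma trueEmp_le_biasedEmp (hℓ : ∀ t b, I.loss t ω b ∈ Set.Icc (0 : ℝ) 1) (T : ℕ)
    (π : X → Fin K) : I.trueEmp T ω π ≤ I.biasedEmp T ω π := by
  unfold trueEmp biasedEmp empLoss
  gcongr with t _
  exact le_pessimisticLoss (hℓ t) _

lemma biasedEmp_eq_trueEmp {T : ℕ} {π : X → Fin K}
    (hexplored : ∀ t < T, π (I.x t ω) ∈ I.explored t ω) :
    I.biasedEmp T ω π = I.trueEmp T ω π := by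
  unfold trueEmp biasedEmp empLoss
  congr 1
  refine Finset.sum_congr rfl fun t ht => ?_
  simp only [biasedLoss, if_pos (hexplored t (Finset.mem_range.mp ht))]

variable [MeasurableSpace X] {D : Measure (X × (Fin K → ℝ))} [IsProbabilityMeasure D]
  {P : Finset (X → Fin K)} {ε δ : ℝ} {πstar : X → Fin K}

lemma expLoss_gap_le_ipsEmp_gap_add_threshold {π : X → Fin K}
    (hδ : δ ∈ Set.Ioo (0 : ℝ) 1) (hε : 0 ≤ ε) (hπ : π ∈ P)
    (hℓ : ∀ t b, I.loss t ω b ∈ Set.Icc (0 : ℝ) 1) (hω : ω ∈ I.deviationEvent D P πstar ε δ)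
    {T : ℕ} (hT : 1 ≤ T) (hexplored : ∀ t < T, πstar (I.x t ω) ∈ I.explored t ω) :
    expLoss D π - expLoss D πstar
      ≤ I.ipsEmp ε T ω π - I.ipsEmp ε T ω πstar + threshold K P.card ε δ T := by
  obtain ⟨hips, hloss⟩ := hω π hπ T hT
  have hthreshold := deviation_bounds_le_threshold (K := K) (ρ := disagreement D π πstar) hε
    measureReal_le_one (confTerm_nonneg (Finset.card_pos.mpr ⟨π, hπ⟩) hδ T)
  have hpessimistic := trueEmp_le_biasedEmp hℓ T π
  have hunbiased := biasedEmp_eq_trueEmp hexplored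
  linarith [(abs_le.mp hips).1, (abs_le.mp hloss).1]

namespace IsRun

variable [mΩ : MeasurableSpace Ω] {ℱ : Filtration ℕ mΩ} {μ : Measure Ω}

lemma star_mem_explored (h : I.IsRun ℱ μ D P ε δ) (hδ : δ ∈ Set.Ioo (0 : ℝ) 1) (hε : 0 ≤ ε)
    (hstar : πstar ∈ P) (hmin : ∀ π ∈ P, expLoss D πstar ≤ expLoss D π)
    (hℓ : ∀ t b, I.loss t ω b ∈ Set.Icc (0 : ℝ) 1) (hω : ω ∈ I.deviationEvent D P πstar ε δ)
    (t : ℕ) : πstar (I.x t ω) ∈ I.explored t ω := by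
  induction t using Nat.strong_induction_on with
  | _ t ih =>
    rcases Nat.eq_zero_or_pos t with rfl | ht
    · simp [h.explored_zero]
    · have hgap := expLoss_gap_le_ipsEmp_gap_add_threshold hδ hε (h.greedy_mem t ω) hℓ hω ht ih
      have hnonneg := hmin _ (h.greedy_mem t ω)
      exact (h.mem_explored t ht ω _).mpr ⟨πstar, hstar, rfl, by linarith⟩

theorem expLoss_greedy_sub_le_threshold (h : I.IsRun ℱ μ D P ε δ)
    (hδ : δ ∈ Set.Ioo (0 : ℝ) 1) (hε : 0 ≤ ε)
    (hstar : πstar ∈ P) (hmin : ∀ π ∈ P, expLoss D πstar ≤ expLoss D π)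
    (hℓ : ∀ t b, I.loss t ω b ∈ Set.Icc (0 : ℝ) 1) (hω : ω ∈ I.deviationEvent D P πstar ε δ)
    {t : ℕ} (ht : 1 ≤ t) :
    expLoss D (I.greedy t ω) - expLoss D πstar ≤ threshold K P.card ε δ t := by
  have hgap := expLoss_gap_le_ipsEmp_gap_add_threshold hδ hε (h.greedy_mem t ω) hℓ hω ht
    fun s _ => h.star_mem_explored hδ hε hstar hmin hℓ hω s
  linarith [h.greedy_min t ω πstar hstar]

end IsRun

end Interaction

/-! ### The regret of one round -/

namespace Interaction

variable {X Ω : Type*} {K : ℕ} {I : Interaction X Ω K} {πstar : X → Fin K}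

/-- The regret of the action played in round `t` with respect to the policy `πstar`. -/
def roundRegret (I : Interaction X Ω K) (πstar : X → Fin K) (t : ℕ) (ω : Ω) : ℝ :=
  I.loss t ω (I.act t ω) - I.loss t ω (πstar (I.x t ω))

lemma regret_eq_sum_roundRegret (I : Interaction X Ω K) (πstar : X → Fin K) (T : ℕ) (ω : Ω) :
    I.regret πstar T ω = ∑ t ∈ Finset.range T, I.roundRegret πstar t ω := by
  simp only [regret, roundRegret, Finset.sum_sub_distrib]

namespace IsRun

variable [MeasurableSpace X] [mΩ : MeasurableSpace Ω] {ℱ : Filtration ℕ mΩ} {μ : Measure Ω}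
  {D : Measure (X × (Fin K → ℝ))} {P : Finset (X → Fin K)} {ε δ : ℝ}

lemma measurable_roundRegret (h : I.IsRun ℱ μ D P ε δ) (hstar : Measurable πstar) (t : ℕ) :
    Measurable[ℱ (t + 1)] (I.roundRegret πstar t) :=
  (measurable_eval (h.measurable_act t)
    fun b => (I.measurable_loss_preAct ℱ t b).mono (h.preAct_le_succ t) le_rfl).sub
      (h.measurable_policy_trueLoss hstar t)

lemma ae_abs_loss_sub_loss_le (h : I.IsRun ℱ μ D P ε δ) (hD : HasUnitLosses D) :
    ∀ᵐ ω ∂μ, ∀ t a b, |I.loss t ω a - I.loss t ω b| ≤ 1 :=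
  (h.ae_loss_mem_Icc hD).mono fun _ hℓ t a b =>
    abs_sub_le_of_nonneg_of_le (hℓ t a).1 (hℓ t a).2 (hℓ t b).1 (hℓ t b).2

variable [IsProbabilityMeasure μ]

lemma integrable_roundRegret (h : I.IsRun ℱ μ D P ε δ) (hD : HasUnitLosses D)
    (hstar : Measurable πstar) (t : ℕ) : Integrable (I.roundRegret πstar t) μ :=
  .of_bound ((h.measurable_roundRegret hstar t).mono (ℱ.le _) le_rfl).aestronglyMeasurable 1
    ((h.ae_abs_loss_sub_loss_le hD).mono fun _ hℓ => hℓ t _ _)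

lemma condExp_preAct_roundRegret_le (h : I.IsRun ℱ μ D P ε δ) (hD : HasUnitLosses D)
    (hδ : δ ∈ Set.Ioo (0 : ℝ) 1) (hε : ε ∈ Set.Ioc (0 : ℝ) 1) (hstar : Measurable πstar) (t : ℕ) :
    μ[I.roundRegret πstar t | I.preAct ℱ t] ≤ᵐ[μ] fun ω =>
      I.loss t ω (I.greedy t ω (I.x t ω)) - I.loss t ω (πstar (I.x t ω)) + ε := by
  have hact := h.condExp_act (t := t) (C := 1)
    (F := fun a ω => I.loss t ω a - I.loss t ω (πstar (I.x t ω)))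
    (fun a => (I.measurable_loss_preAct ℱ t a).sub
      (measurable_eval (I.measurable_policy_preAct ℱ t hstar) (I.measurable_loss_preAct ℱ t)))
    ((h.ae_abs_loss_sub_loss_le hD).mono fun _ hℓ a => hℓ t a _)
  filter_upwards [hact, h.ae_loss_mem_Icc hD] with ω hω hℓ
  have hprob := h.isExploration_prob hδ hε t ω
  refine hω.trans_le ?_
  simp only [mul_sub, Finset.sum_sub_distrib, ← Finset.sum_mul, hprob.sum_eq_one, one_mul]
  have hexplore := sum_mul_le_add_of_one_sub_le hprob.nonneg hprob.sum_eq_one (hℓ t)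
    (one_sub_le_playProb_self hε.1.le)
  linarith

variable [IsProbabilityMeasure D]

lemma condExp_greedy_loss_sub (h : I.IsRun ℱ μ D P ε δ) (hP : ∀ π ∈ P, Measurable π)
    (hD : HasUnitLosses D) (hstar : Measurable πstar) (t : ℕ) :
    μ[fun ω => I.loss t ω (I.greedy t ω (I.x t ω)) - I.loss t ω (πstar (I.x t ω)) | ℱ t]
      =ᵐ[μ] fun ω => expLoss D (I.greedy t ω) - expLoss D πstar := by
  have hint : ∀ π ∈ P,
      Integrable (fun ω => I.loss t ω (π (I.x t ω)) - I.loss t ω (πstar (I.x t ω))) μ :=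
    fun π hπ => .of_bound (((h.measurable_policy_trueLoss (hP π hπ) t).sub
      (h.measurable_policy_trueLoss hstar t)).mono (ℱ.le _) le_rfl).aestronglyMeasurable 1
      ((h.ae_abs_loss_sub_loss_le hD).mono fun _ hℓ => hℓ t _ _)
  have hmean : ∀ᵐ ω ∂μ, ∀ π ∈ P,
      (μ[fun ω => I.loss t ω (π (I.x t ω)) - I.loss t ω (πstar (I.x t ω)) | ℱ t]) ω
        = expLoss D π - expLoss D πstar := by
    refine (ae_ball_iff P.countable_toSet).mpr fun π hπ => ?_
    rw [← hD.integral_policy_loss_sub (hP π hπ) hstar]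
    exact h.condExp_data t ((measurable_policy_loss (hP π hπ)).sub (measurable_policy_loss hstar))
  filter_upwards [hmean, condExp_eval_of_measurable_choice (h.greedy_mem t) (ℱ.le t)
    (h.measurable_greedy t) hint] with ω hω hchoice
  rw [hchoice, hω _ (h.greedy_mem t ω)]

theorem condExp_roundRegret_le (h : I.IsRun ℱ μ D P ε δ) (hP : ∀ π ∈ P, Measurable π)
    (hD : HasUnitLosses D) (hδ : δ ∈ Set.Ioo (0 : ℝ) 1) (hε : ε ∈ Set.Ioc (0 : ℝ) 1)
    (hstar : Measurable πstar) (t : ℕ) :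
    μ[I.roundRegret πstar t | ℱ t]
      ≤ᵐ[μ] fun ω => expLoss D (I.greedy t ω) - expLoss D πstar + ε := by
  set G : Ω → ℝ := fun ω =>
    I.loss t ω (I.greedy t ω (I.x t ω)) - I.loss t ω (πstar (I.x t ω))
  have hGint : Integrable G μ := by
    refine .of_bound (Measurable.aestronglyMeasurable ?_) 1
      ((h.ae_abs_loss_sub_loss_le hD).mono fun _ hℓ => hℓ t _ _)
    exact ((measurable_eval (h.measurable_greedyAction hP t)
      (I.measurable_loss_preAct ℱ t)).mono (h.preAct_le t) le_rfl).sub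
        ((h.measurable_policy_trueLoss hstar t).mono (ℱ.le _) le_rfl)
  have hmono := condExp_mono (m := ℱ t) integrable_condExp (hGint.add (integrable_const ε))
    (h.condExp_preAct_roundRegret_le hD hδ hε hstar t)
  filter_upwards [hmono, h.condExp_greedy_loss_sub hP hD hstar t,
    condExp_add hGint (integrable_const ε) (ℱ t),
    condExp_condExp_of_le (f := I.roundRegret πstar t) (I.le_preAct ℱ t) (h.preAct_le t)]
    with ω hle hgreedy hadd htower
  rwa [htower, hadd, Pi.add_apply, condExp_const (ℱ.le t), hgreedy] at hle

end IsRun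

end Interaction

/-! ### The regret on the deviation event -/

lemma sum_inv_sqrt_succ_le (T : ℕ) : ∑ t ∈ Finset.range T, 1 / √((t : ℝ) + 1) ≤ 2 * √T := by
  induction T with
  | zero => simp
  | succ T ih =>
    have hpos : 0 < √((T : ℝ) + 1) := Real.sqrt_pos.mpr (by positivity)
    have hstep : 1 / √((T : ℝ) + 1) ≤ 2 * √((T : ℝ) + 1) - 2 * √T := by
      rw [div_le_iff₀ hpos]
      nlinarith [sq_nonneg (√((T : ℝ) + 1) - √T), Real.sq_sqrt (Nat.cast_nonneg (α := ℝ) T),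
        Real.sq_sqrt (by positivity : (0 : ℝ) ≤ (T : ℝ) + 1)]
    rw [Finset.sum_range_succ]
    push_cast
    linarith

lemma half_le_log {N T : ℕ} {δ : ℝ} (hN : 2 ≤ N) (hT : 1 ≤ T) (hδ : δ ∈ Set.Ioo (0 : ℝ) 1) :
    1 / 2 ≤ Real.log (T * N / δ) := by
  have hN2 : (2 : ℝ) ≤ N := by exact_mod_cast hN
  have hT1 : (1 : ℝ) ≤ T := by exact_mod_cast hT
  have hlog : Real.log 2 ≤ Real.log (T * N / δ) :=
    Real.log_le_log two_pos ((le_div_iff₀ hδ.1).mpr (by nlinarith [hδ.2]))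
  linarith [Real.log_two_gt_d9]

lemma confTerm_le {N t T : ℕ} {δ : ℝ} (hN : 2 ≤ N) (ht : 1 ≤ t) (htT : t < T)
    (hδ : δ ∈ Set.Ioo (0 : ℝ) 1) : confTerm N δ t ≤ 4 * (Real.log (T * N / δ) / (t + 1)) := by
  obtain ⟨hδ0, hδ1⟩ := hδ
  have hN2 : (2 : ℝ) ≤ N := by exact_mod_cast hN
  have ht1 : (1 : ℝ) ≤ t := by exact_mod_cast ht
  have htT1 : (t : ℝ) + 1 ≤ T := by exact_mod_cast htT
  have hlog0 := half_le_log hN (by omega : 1 ≤ T) ⟨hδ0, hδ1⟩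
  have hlog : Real.log (2 * N / (δ / ((t : ℝ) ^ 2 + t))) ≤ 2 * Real.log (T * N / δ) := by
    rw [← Nat.cast_two, ← Real.log_pow]
    refine Real.log_le_log (by positivity) ?_
    calc (2 : ℕ) * N / (δ / ((t : ℝ) ^ 2 + t)) = 2 * N * ((t : ℝ) ^ 2 + t) / δ := by
          push_cast; rw [div_div_eq_mul_div]
      _ ≤ N * N * T ^ 2 / (δ * δ) := by
          gcongr
          · nlinarith
          · exact mul_le_of_le_one_left hδ0.le hδ1.le
      _ = (T * N / δ) ^ 2 := by ring
  calc confTerm N δ t ≤ 2 * Real.log (T * N / δ) / t := by unfold confTerm; gcongr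
    _ ≤ 2 * Real.log (T * N / δ) / ((t + 1) / 2) := by gcongr; linarith
    _ = 4 * (Real.log (T * N / δ) / (t + 1)) := by field_simp; ring

lemma min_one_threshold_le {K N T : ℕ} {ε δ : ℝ} (hκ : 1 ≤ (K : ℝ) / ε)
    (he : 0 ≤ confTerm N δ T) :
    min 1 (threshold K N ε δ T) ≤ 9 * √(K / ε * confTerm N δ T) := by
  unfold threshold
  set e := confTerm N δ T
  set q := √(K / ε * e)
  have hq2 : q ^ 2 = K / ε * e := Real.sq_sqrt (by positivity)
  have hq0 : 0 ≤ q := Real.sqrt_nonneg _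
  have heq : e ≤ q ^ 2 := hq2 ▸ le_mul_of_one_le_left he hκ
  have hroot : √(2 * K / ε) * √e ≤ 3 / 2 * q := by
    rw [← Real.sqrt_mul' _ he]
    exact Real.sqrt_le_iff.mpr ⟨by positivity, by nlinarith [mul_div_assoc 2 (K : ℝ) ε]⟩
  have hroot' : √e ≤ q := Real.sqrt_le_iff.mpr ⟨hq0, heq⟩
  rcases le_total q 1 with hq1 | hq1
  · refine (min_le_right _ _).trans ?_
    nlinarith
  · exact (min_le_left _ _).trans (by linarith)

lemma one_le_two_mul_sqrt {K N T : ℕ} {ε δ : ℝ} (hκ : 1 ≤ (K : ℝ) / ε) (hN : 2 ≤ N) (hT : 1 ≤ T)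
    (hδ : δ ∈ Set.Ioo (0 : ℝ) 1) : 1 ≤ 2 * √(K / ε * Real.log (T * N / δ)) := by
  have hsqrt : 1 / 2 ≤ √(K / ε * Real.log (T * N / δ)) :=
    Real.le_sqrt_of_sq_le (by nlinarith [half_le_log hN hT hδ])
  linarith

lemma rate_eq (K N T : ℕ) (δ ε : ℝ) :
    rate K N T δ ε = √T * √(K / ε * Real.log (T * N / δ)) + T * ε := by
  rw [rate, ← Real.sqrt_mul (Nat.cast_nonneg T)]
  ring_nf

lemma one_le_numActions {X : Type*} [MeasurableSpace X] {K : ℕ} (D : Measure (X × (Fin K → ℝ)))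
    [IsProbabilityMeasure D] (π : X → Fin K) : 1 ≤ K := by
  obtain ⟨z⟩ := nonempty_of_isProbabilityMeasure D
  exact Fin.pos (π z.1)

lemma one_le_numActions_div {X : Type*} [MeasurableSpace X] {K : ℕ} {ε : ℝ}
    (D : Measure (X × (Fin K → ℝ))) [IsProbabilityMeasure D] (π : X → Fin K)
    (hε : ε ∈ Set.Ioc (0 : ℝ) 1) : 1 ≤ (K : ℝ) / ε :=
  (one_le_div hε.1).mpr (hε.2.trans (by exact_mod_cast one_le_numActions D π))

namespace Interaction

variable {X Ω : Type*} {K : ℕ} [MeasurableSpace X] {D : Measure (X × (Fin K → ℝ))}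
  {P : Finset (X → Fin K)} {ε δ : ℝ} {πstar : X → Fin K}

lemma deviationEvent_eq_univ (I : Interaction X Ω K) (hδ : δ ∈ Set.Ioo (0 : ℝ) 1)
    (hε : 0 ≤ ε) (hstar : πstar ∈ P) (hcard : P.card = 1) :
    I.deviationEvent D P πstar ε δ = Set.univ := by
  refine Set.eq_univ_of_forall fun ω π hπ T _ => ?_
  obtain rfl : π = πstar := Finset.card_le_one.mp hcard.le π hπ πstar hstar
  have := confTerm_nonneg hcard.ge hδ T
  simp only [sub_self, abs_zero]
  constructor <;> positivity

namespace IsRun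

variable [mΩ : MeasurableSpace Ω] {I : Interaction X Ω K} {ℱ : Filtration ℕ mΩ} {μ : Measure Ω}

lemma expLoss_greedy_sub_le [IsProbabilityMeasure D] (h : I.IsRun ℱ μ D P ε δ)
    (hP : ∀ π ∈ P, Measurable π) (hD : HasUnitLosses D) (hδ : δ ∈ Set.Ioo (0 : ℝ) 1)
    (hε : ε ∈ Set.Ioc (0 : ℝ) 1) (hstar : πstar ∈ P)
    (hmin : ∀ π ∈ P, expLoss D πstar ≤ expLoss D π) (hcard : 2 ≤ P.card) {ω : Ω}
    (hℓ : ∀ t b, I.loss t ω b ∈ Set.Icc (0 : ℝ) 1) (hω : ω ∈ I.deviationEvent D P πstar ε δ)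
    {t T : ℕ} (htT : t < T) :
    expLoss D (I.greedy t ω) - expLoss D πstar
      ≤ 18 * √(K / ε * Real.log (T * P.card / δ)) * (1 / √((t : ℝ) + 1)) := by
  have hκ := one_le_numActions_div D πstar hε
  have hroot : √(K / ε * (4 * (Real.log (T * P.card / δ) / (t + 1))))
      = 2 * √(K / ε * Real.log (T * P.card / δ)) * (1 / √((t : ℝ) + 1)) := by
    rw [mul_one_div, ← Real.sqrt_sq zero_le_two, ← Real.sqrt_mul (by positivity),
      ← Real.sqrt_div' _ (by positivity)]
    ring_nf
  have htrivial : expLoss D (I.greedy t ω) - expLoss D πstar ≤ 1 := by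
    linarith [(hD.expLoss_mem_Icc (hP _ (h.greedy_mem t ω))).2, (hD.expLoss_mem_Icc (hP _ hstar)).1]
  rcases Nat.eq_zero_or_pos t with rfl | ht
  · have hone := one_le_two_mul_sqrt hκ hcard (Nat.one_le_of_lt htT) hδ
    simp only [Nat.cast_zero, zero_add, Real.sqrt_one, div_one, mul_one]
    linarith
  · have he := confTerm_nonneg (by omega : 1 ≤ P.card) hδ t
    calc expLoss D (I.greedy t ω) - expLoss D πstar ≤ min 1 (threshold K P.card ε δ t) :=
          le_min htrivial (h.expLoss_greedy_sub_le_threshold hδ hε.1.le hstar hmin hℓ hω ht)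
      _ ≤ 9 * √(K / ε * confTerm P.card δ t) := min_one_threshold_le hκ he
      _ ≤ 9 * √(K / ε * (4 * (Real.log (T * P.card / δ) / (t + 1)))) := by
          gcongr
          exact confTerm_le hcard ht htT hδ
      _ = _ := by rw [hroot]; ring

variable [IsProbabilityMeasure μ]

lemma integrable_regret (h : I.IsRun ℱ μ D P ε δ) (hD : HasUnitLosses D)
    (hstar : Measurable πstar) (T : ℕ) : Integrable (I.regret πstar T) μ := by
  simpa only [← regret_eq_sum_roundRegret] using
    integrable_finsetSum (Finset.range T) fun t _ => h.integrable_roundRegret hD hstar t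

variable [IsProbabilityMeasure D]

lemma ae_sum_condExp_roundRegret_le (h : I.IsRun ℱ μ D P ε δ) (hP : ∀ π ∈ P, Measurable π)
    (hD : HasUnitLosses D) (hδ : δ ∈ Set.Ioo (0 : ℝ) 1) (hε : ε ∈ Set.Ioc (0 : ℝ) 1)
    (hstar : πstar ∈ P) (hmin : ∀ π ∈ P, expLoss D πstar ≤ expLoss D π)
    (hcard : 2 ≤ P.card) (T : ℕ) :
    ∀ᵐ ω ∂μ, ω ∈ I.deviationEvent D P πstar ε δ →
      ∑ t ∈ Finset.range T, (μ[I.roundRegret πstar t | ℱ t]) ω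
        ≤ 36 * (√T * √(K / ε * Real.log (T * P.card / δ))) + T * ε := by
  filter_upwards [h.ae_loss_mem_Icc hD,
    ae_all_iff.mpr fun t => h.condExp_roundRegret_le hP hD hδ hε (hP _ hstar) t] with ω hℓ hround hω
  set S := √(K / ε * Real.log (T * P.card / δ))
  have hgap : ∀ t ∈ Finset.range T, (μ[I.roundRegret πstar t | ℱ t]) ω
      ≤ 18 * S * (1 / √((t : ℝ) + 1)) + ε := fun t ht => (hround t).trans (add_le_add_left
    (h.expLoss_greedy_sub_le hP hD hδ hε hstar hmin hcard hℓ hω (Finset.mem_range.mp ht)) ε)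
  calc ∑ t ∈ Finset.range T, (μ[I.roundRegret πstar t | ℱ t]) ω
      ≤ ∑ t ∈ Finset.range T, (18 * S * (1 / √((t : ℝ) + 1)) + ε) := Finset.sum_le_sum hgap
    _ = 18 * S * ∑ t ∈ Finset.range T, 1 / √((t : ℝ) + 1) + T * ε := by
        rw [Finset.sum_add_distrib, Finset.mul_sum, Finset.sum_const, Finset.card_range,
          nsmul_eq_mul]
    _ ≤ 18 * S * (2 * √T) + T * ε := by grw [sum_inv_sqrt_succ_le T]
    _ = 36 * (√T * S) + T * ε := by ring

lemma integral_regret_le_of_card_eq_one (h : I.IsRun ℱ μ D P ε δ) (hP : ∀ π ∈ P, Measurable π)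
    (hD : HasUnitLosses D) (hδ : δ ∈ Set.Ioo (0 : ℝ) 1) (hε : ε ∈ Set.Ioc (0 : ℝ) 1)
    (hstar : πstar ∈ P) (hcard : P.card = 1) (T : ℕ) : ∫ ω, I.regret πstar T ω ∂μ ≤ T * ε := by
  have hround : ∀ t, ∫ ω, I.roundRegret πstar t ω ∂μ ≤ ε := fun t => by
    have hdrift : μ[I.roundRegret πstar t | ℱ t] ≤ᵐ[μ] fun _ => ε := by
      filter_upwards [h.condExp_roundRegret_le hP hD hδ hε (hP _ hstar) t] with ω hω
      rwa [Finset.card_le_one.mp hcard.le _ (h.greedy_mem t ω) _ hstar, sub_self, zero_add] at hω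
    rw [← integral_condExp (ℱ.le t)]
    exact (integral_mono_ae integrable_condExp (integrable_const ε) hdrift).trans_eq (by simp)
  simp only [regret_eq_sum_roundRegret]
  rw [integral_finsetSum _ fun t _ => h.integrable_roundRegret hD (hP _ hstar) t]
  exact (Finset.sum_le_sum fun t _ => hround t).trans_eq (by simp)

theorem integral_regret_cond_le (h : I.IsRun ℱ μ D P ε δ) (hP : ∀ π ∈ P, Measurable π)
    (hD : HasUnitLosses D) (hδ : δ ∈ Set.Ioo (0 : ℝ) 1) (hε : ε ∈ Set.Ioc (0 : ℝ) 1)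
    (hstar : πstar ∈ P) (hmin : ∀ π ∈ P, expLoss D πstar ≤ expLoss D π) {T : ℕ} (hT : 1 ≤ T) :
    ∫ ω, I.regret πstar T ω ∂μ[|I.deviationEvent D P πstar ε δ] ≤ 80 * rate K P.card T δ ε := by
  have hTε : 0 ≤ T * ε := mul_nonneg (Nat.cast_nonneg T) hε.1.le
  rw [rate_eq]
  set S := √(K / ε * Real.log (T * P.card / δ))
  have hS : 0 ≤ √T * S := by positivity
  obtain hone | htwo := (Nat.succ_le_of_lt (Finset.card_pos.mpr ⟨_, hstar⟩)).eq_or_lt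
  · rw [deviationEvent_eq_univ I hδ hε.1.le hstar hone.symm, cond_univ]
    linarith [h.integral_regret_le_of_card_eq_one hP hD hδ hε hstar hone.symm T]
  have hhalf : 1 / 2 ≤ μ.real (I.deviationEvent D P πstar ε δ) := by
    linarith [h.one_sub_half_le_measureReal_deviationEvent hP hD hδ hε hstar, hδ.2]
  have hsqrt : √T ≤ 2 * (√T * S) := by
    have hone := one_le_two_mul_sqrt (one_le_numActions_div D πstar hε) htwo hT hδ
    nlinarith [Real.sqrt_nonneg T]
  have hset : ∫ ω in I.deviationEvent D P πstar ε δ, I.regret πstar T ω ∂μ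
      ≤ 2 * 1 * √T + (36 * (√T * S) + T * ε) := by
    simp only [regret_eq_sum_roundRegret]
    exact setIntegral_sum_le_of_sum_condExp_le (h.measurable_roundRegret (hP _ hstar))
      (fun t => (h.ae_abs_loss_sub_loss_le hD).mono fun _ hℓ => hℓ t _ _) zero_le_one
      (h.measurableSet_deviationEvent hP hD hδ hε hstar) (by positivity) T
      (h.ae_sum_condExp_roundRegret_le hP hD hδ hε hstar hmin htwo T)
  have hcond := integral_cond_le_div one_half_pos hhalf (by positivity) hset
  linarith

end IsRun

end Interaction

/-! ### Tuning the exploration probability -/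

lemma isMinOn_two_mul_mul_sqrt_div_add {y b : ℝ} (hy : 0 < y) (hb : 0 < b) :
    IsMinOn (fun ε => 2 * y * √(y / ε) + ε) (Set.Ioc 0 b) (min b y) := by
  intro ε hε
  have hm : 0 < min b y := lt_min hb hy
  -- In the variable `s = √ε` the function is `2 r³ / s + s²`.
  have hroot : ∀ {x : ℝ}, 0 < x → 2 * y * √(y / x) + x = 2 * √y ^ 3 / √x + √x ^ 2 := fun hx => by
    rw [Real.sqrt_div hy.le, Real.sq_sqrt hx.le, pow_succ, Real.sq_sqrt hy.le]
    ring
  refine (hroot hm).trans_le (le_of_le_of_eq ?_ (hroot hε.1).symm)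
  have hs : 0 < √ε := Real.sqrt_pos.mpr hε.1
  have hm0 : 0 < √(min b y) := Real.sqrt_pos.mpr hm
  have hmy : √(min b y) ≤ √y := Real.sqrt_le_sqrt (min_le_right b y)
  have hcase : √ε ≤ √(min b y) ∨ √(min b y) = √y := by
    rcases le_total b y with h | h
    · exact .inl (Real.sqrt_le_sqrt (hε.2.trans_eq (min_eq_left h).symm))
    · exact .inr (by rw [min_eq_right h])
  generalize √ε = s at *
  generalize √(min b y) = m at *
  generalize √y = r at *
  have hprod : 0 ≤ (m - s) * (2 * r ^ 3 - s * m * (s + m)) := by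
    rcases hcase with hsm | rfl
    · refine mul_nonneg (sub_nonneg.mpr hsm) (sub_nonneg.mpr ?_)
      have hr : 0 < r := hm0.trans_le hmy
      have hsr : s ≤ r := hsm.trans hmy
      calc s * m * (s + m) ≤ r * r * (r + r) := by gcongr
        _ = 2 * r ^ 3 := by ring
    · have hfactor : (m - s) * (2 * m ^ 3 - s * m * (s + m)) = m * (m - s) ^ 2 * (2 * m + s) := by
        ring
      rw [hfactor]
      positivity
  have hdiff : 2 * r ^ 3 / s + s ^ 2 - (2 * r ^ 3 / m + m ^ 2)
      = (m - s) * (2 * r ^ 3 - s * m * (s + m)) / (s * m) := by field_simp; ring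
  exact sub_nonneg.mp (hdiff ▸ div_nonneg hprod (by positivity))

/-- The minimizer of `rate` over all positive exploration probabilities; `tunedEps` is its
truncation at `1`. -/
noncomputable def freeEps (K N T : ℕ) (δ : ℝ) : ℝ :=
  (K * Real.log (T * N / δ) / (4 * T)) ^ (1 / 3 : ℝ)

section Tuning

variable {K N T : ℕ} {δ ε : ℝ}

lemma rate_nonneg (hε : 0 ≤ ε) : 0 ≤ rate K N T δ ε := by
  unfold rate
  positivity

lemma log_mul_div_pos (hN : 1 ≤ N) (hT : 1 ≤ T) (hδ : δ ∈ Set.Ioo (0 : ℝ) 1) :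
    0 < Real.log (T * N / δ) := by
  have hTN : (1 : ℝ) ≤ T * N := by exact_mod_cast Nat.mul_pos hT hN
  exact Real.log_pos ((one_lt_div hδ.1).mpr (hδ.2.trans_le hTN))

lemma freeEps_pos (hK : 1 ≤ K) (hN : 1 ≤ N) (hT : 1 ≤ T) (hδ : δ ∈ Set.Ioo (0 : ℝ) 1) :
    0 < freeEps K N T δ := by
  have hlog := log_mul_div_pos hN hT hδ
  unfold freeEps
  positivity

lemma freeEps_pow_three (hN : 1 ≤ N) (hT : 1 ≤ T) (hδ : δ ∈ Set.Ioo (0 : ℝ) 1) :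
    freeEps K N T δ ^ 3 = K * Real.log (T * N / δ) / (4 * T) := by
  have hlog := log_mul_div_pos hN hT hδ
  rw [freeEps, ← Real.rpow_natCast, ← Real.rpow_mul (by positivity)]
  norm_num

lemma tunedEps_mem_Ioc (hK : 1 ≤ K) (hN : 1 ≤ N) (hT : 1 ≤ T) (hδ : δ ∈ Set.Ioo (0 : ℝ) 1) :
    tunedEps K N T δ ∈ Set.Ioc (0 : ℝ) 1 :=
  ⟨lt_min one_pos (freeEps_pos hK hN hT hδ), min_le_left _ _⟩

lemma rate_eq_mul_freeEps (hK : 1 ≤ K) (hN : 1 ≤ N) (hT : 1 ≤ T) (hδ : δ ∈ Set.Ioo (0 : ℝ) 1) :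
    rate K N T δ ε = T * (2 * freeEps K N T δ * √(freeEps K N T δ / ε) + ε) := by
  have hy := freeEps_pos hK hN hT hδ
  have hlog : K * Real.log (T * N / δ) = 4 * T * freeEps K N T δ ^ 3 := by
    rw [freeEps_pow_three hN hT hδ]
    field_simp
  set y := freeEps K N T δ
  calc rate K N T δ ε = √((2 * T * y) ^ 2 * (y / ε)) + T * ε := by
        rw [rate, mul_right_comm, hlog]
        ring_nf
    _ = T * (2 * y * √(y / ε) + ε) := by
        rw [Real.sqrt_mul (sq_nonneg _), Real.sqrt_sq (by positivity)]
        ring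

lemma isMinOn_rate_tunedEps (hK : 1 ≤ K) (hN : 1 ≤ N) (hT : 1 ≤ T)
    (hδ : δ ∈ Set.Ioo (0 : ℝ) 1) :
    IsMinOn (rate K N T δ) (Set.Ioc 0 1) (tunedEps K N T δ) := fun ε hε => by
  rw [Set.mem_ofPred_eq, rate_eq_mul_freeEps hK hN hT hδ, rate_eq_mul_freeEps hK hN hT hδ]
  exact mul_le_mul_of_nonneg_left
    (isMinOn_two_mul_mul_sqrt_div_add (freeEps_pos hK hN hT hδ) one_pos hε) (Nat.cast_nonneg T)

lemma rate_freeEps (hK : 1 ≤ K) (hN : 1 ≤ N) (hT : 1 ≤ T) (hδ : δ ∈ Set.Ioo (0 : ℝ) 1) :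
    rate K N T δ (freeEps K N T δ) = 3 * (T * freeEps K N T δ) := by
  rw [rate_eq_mul_freeEps hK hN hT hδ, div_self (freeEps_pos hK hN hT hδ).ne', Real.sqrt_one]
  ring

lemma mul_freeEps_le (hN : 1 ≤ N) (hT : 1 ≤ T) (hδ : δ ∈ Set.Ioo (0 : ℝ) 1) :
    T * freeEps K N T δ
      ≤ (T : ℝ) ^ (2 / 3 : ℝ) * (K * Real.log (T * N / δ)) ^ (1 / 3 : ℝ) := by
  have hlog := log_mul_div_pos hN hT hδ
  have hT0 : (0 : ℝ) < T := by exact_mod_cast hT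
  calc T * freeEps K N T δ ≤ T * (K * Real.log (T * N / δ) / T) ^ (1 / 3 : ℝ) := by
        unfold freeEps
        gcongr
        linarith
    _ = (T : ℝ) ^ (1 - 1 / 3 : ℝ) * (K * Real.log (T * N / δ)) ^ (1 / 3 : ℝ) := by
        rw [Real.div_rpow (by positivity) hT0.le, Real.rpow_sub hT0, Real.rpow_one]
        ring
    _ = _ := by norm_num

end Tuning

namespace Interaction.IsRun

variable {X Ω : Type*} {K : ℕ} [MeasurableSpace X] {D : Measure (X × (Fin K → ℝ))}
  {P : Finset (X → Fin K)} {ε δ : ℝ} {πstar : X → Fin K} [mΩ : MeasurableSpace Ω]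
  {I : Interaction X Ω K} {ℱ : Filtration ℕ mΩ} {μ : Measure Ω}

lemma integral_regret_le_horizon {ν : Measure Ω} [IsProbabilityMeasure ν]
    (h : I.IsRun ℱ μ D P ε δ) (hD : HasUnitLosses D) (hν : ν ≪ μ) (T : ℕ) :
    ∫ ω, I.regret πstar T ω ∂ν ≤ T := by
  have hbound : ∀ᵐ ω ∂ν, ‖I.regret πstar T ω‖ ≤ T := by
    filter_upwards [hν.ae_le (h.ae_abs_loss_sub_loss_le hD)] with ω hℓ
    rw [regret_eq_sum_roundRegret]
    exact (norm_sum_le_of_le (Finset.range T) fun t _ => hℓ t _ _).trans_eq (by simp)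
  simpa using (Real.le_norm_self _).trans (norm_integral_le_of_norm_le_const hbound)

variable [IsProbabilityMeasure μ] [IsProbabilityMeasure D]

theorem integral_regret_cond_tunedEps_le {T : ℕ} (h : I.IsRun ℱ μ D P (tunedEps K P.card T δ) δ)
    (hP : ∀ π ∈ P, Measurable π) (hD : HasUnitLosses D) (hδ : δ ∈ Set.Ioo (0 : ℝ) 1)
    (hstar : πstar ∈ P) (hmin : ∀ π ∈ P, expLoss D πstar ≤ expLoss D π) (hT : 1 ≤ T) :
    ∫ ω, I.regret πstar T ω ∂μ[|I.deviationEvent D P πstar (tunedEps K P.card T δ) δ]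
      ≤ 240 * ((T : ℝ) ^ (2 / 3 : ℝ) * (K * Real.log (T * P.card / δ)) ^ (1 / 3 : ℝ)) := by
  have hK : 1 ≤ K := one_le_numActions D πstar
  have hN : 1 ≤ P.card := Finset.card_pos.mpr ⟨_, hstar⟩
  have hε := tunedEps_mem_Ioc hK hN hT hδ
  refine le_trans ?_ (mul_le_mul_of_nonneg_left (mul_freeEps_le hN hT hδ) (by norm_num))
  rcases le_total (freeEps K P.card T δ) 1 with hle | hge
  · refine (h.integral_regret_cond_le hP hD hδ hε hstar hmin hT).trans_eq ?_
    have htuned : tunedEps K P.card T δ = freeEps K P.card T δ := min_eq_right hle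
    rw [htuned, rate_freeEps hK hN hT hδ]
    ring
  · have := cond_isProbabilityMeasure (h.measure_deviationEvent_ne_zero hP hD hδ hε hstar)
    have hTy : (T : ℝ) ≤ T * freeEps K P.card T δ := le_mul_of_one_le_right (Nat.cast_nonneg T) hge
    refine (h.integral_regret_le_horizon hD cond_absolutelyContinuous T).trans ?_
    linarith [Nat.cast_nonneg (α := ℝ) T]

end Interaction.IsRun

end ActiveGreedy

theorem mainTheorem4 :
    ∃ C : ℝ, 0 < C ∧
      ∀ (X : Type*) (Ω : Type*) [MeasurableSpace X] [mΩ : MeasurableSpace Ω]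
        (μ : Measure Ω) [IsProbabilityMeasure μ]
        (K : ℕ) (D : Measure (X × (Fin K → ℝ))) [IsProbabilityMeasure D]
        (P : Finset (X → Fin K)) (πstar : X → Fin K) (δ : ℝ),
        (∀ᵐ z ∂D, ∀ b, z.2 b ∈ Set.Icc (0 : ℝ) 1) →
        (∀ π ∈ P, Measurable π) →
        πstar ∈ P →
        (∀ π ∈ P, ActiveGreedy.expLoss D πstar ≤ ActiveGreedy.expLoss D π) →
        0 < δ → δ < 1 →
        -- for every exploration probability
        (∀ (ε : ℝ) (I : ActiveGreedy.Interaction X Ω K) (ℱ : Filtration ℕ mΩ),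
          0 < ε → ε ≤ 1 → I.IsRun ℱ μ D P ε δ →
            MeasurableSet (I.deviationEvent D P πstar ε δ) ∧
            1 - δ ≤ μ.real (I.deviationEvent D P πstar ε δ) ∧
            ∀ T : ℕ, 1 ≤ T →
              Integrable (I.regret πstar T) μ[|I.deviationEvent D P πstar ε δ] ∧
              ∫ ω, I.regret πstar T ω ∂μ[|I.deviationEvent D P πstar ε δ]
                ≤ C * ActiveGreedy.rate K P.card T δ ε) ∧
        -- for the exploration probability that optimizes the bound at horizon `T`
        (∀ T : ℕ, 1 ≤ T →
          ActiveGreedy.tunedEps K P.card T δ ∈ Set.Ioc (0 : ℝ) 1 ∧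
          IsMinOn (ActiveGreedy.rate K P.card T δ) (Set.Ioc 0 1)
            (ActiveGreedy.tunedEps K P.card T δ) ∧
          ∀ (I : ActiveGreedy.Interaction X Ω K) (ℱ : Filtration ℕ mΩ),
            I.IsRun ℱ μ D P (ActiveGreedy.tunedEps K P.card T δ) δ →
              ∫ ω, I.regret πstar T ω
                  ∂μ[|I.deviationEvent D P πstar (ActiveGreedy.tunedEps K P.card T δ) δ]
                ≤ C * ((T : ℝ) ^ (2 / 3 : ℝ)
                    * (K * Real.log (T * P.card / δ)) ^ (1 / 3 : ℝ))) := by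
  refine ⟨240, by norm_num, ?_⟩
  intro X Ω _ mΩ μ _ K D _ P πstar δ hD hP hstar hmin hδ0 hδ1
  have hδ : δ ∈ Set.Ioo (0 : ℝ) 1 := ⟨hδ0, hδ1⟩
  have hK : 1 ≤ K := ActiveGreedy.one_le_numActions D πstar
  have hN : 1 ≤ P.card := Finset.card_pos.mpr ⟨_, hstar⟩
  refine ⟨fun ε I ℱ hε0 hε1 h => ?_, fun T hT =>
    ⟨ActiveGreedy.tunedEps_mem_Ioc hK hN hT hδ, ActiveGreedy.isMinOn_rate_tunedEps hK hN hT hδ,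
      fun I ℱ h => h.integral_regret_cond_tunedEps_le hP hD hδ hstar hmin hT⟩⟩
  have hε : ε ∈ Set.Ioc (0 : ℝ) 1 := ⟨hε0, hε1⟩
  have hprob := h.one_sub_half_le_measureReal_deviationEvent hP hD hδ hε hstar
  refine ⟨h.measurableSet_deviationEvent hP hD hδ hε hstar, by linarith, fun T hT =>
    ⟨ActiveGreedy.integrable_cond (h.measure_deviationEvent_ne_zero hP hD hδ hε hstar)
      (h.integrable_regret hD (hP _ hstar) T), ?_⟩⟩
  linarith [h.integral_regret_cond_le hP hD hδ hε hstar hmin hT,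
    ActiveGreedy.rate_nonneg (K := K) (N := P.card) (T := T) (δ := δ) hε0.le]
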